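/- **Setting.** Let $\alpha,\mu,\lambda,\gamma_0,d_0,R_M,b>0$, $\kappa\ge 0$, $\beta>2$, $m>\max(2/\alpha,1)$, $\delta\in[2,6]$, $a\in\mathbb R$. Let $H_p,H_f,D$ be independent real random variables such that * $H_p^2$ has density $-\frac{\beta^2}{4}\ln(z)\,z^{\beta/2-1}$ on $(0,1)$; * $H_f^2$ has the $\alpha$-$\mathcal F$ density $\frac{\alpha}{2\mathrm B(\mu,m)}K^{m}x^{\alpha\mu/2-1}(x^{\alpha/2}+K)^{-(m+\mu)}$ on $(0,\infty)$, $K=\frac{(m-1)\Omega_f^{\alpha/2}}{\lambda^{\alpha/2}\mu}$, where the power parameter $\Omega_f>0$ (equal to $\mathbb E[H_f^2]$ for the usual value of $\lambda$) satisfies the normalization $\mathbb E[H_p^2]\,\Omega_f=1$; * $D$ has the random waypoint density $\sum_{i=1}^{l}B_i(d_0/R_M)^{\beta_i+1}(d-1)^{\beta_i}$ on $(1,1+R_M/d_0)$, with real $B_i$ and $\beta_i\ge 0$ for which this function is nonnegative. Let $\Gamma=\gamma_0(D-1)^{-\delta}e^{-\kappa d_0D}H_p^2H_f^2$ be the instantaneous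 SNR. For a function $F$ on $(0,\infty)$ put $$P_s[F]=\frac{a\sqrt b}{2\sqrt{2\pi}}\int_0^\infty\gamma^{-1/2}F(\gamma)e^{-b\gamma/2}\,d\gamma ,$$ so that $P_s[F_\Gamma]$, with $F_\Gamma(\gamma)=\Pr(\Gamma\le\gamma)$, is the average symbol error probability. Put $$c_2=\frac{(m-1)(\beta+2)^\alpha}{\lambda^{\alpha/2}\mu\beta^\alpha},\qquad c_1=\frac{\beta^2\alpha}{8\mathrm B(\mu,m)}c_2^{\,m},\qquad \Phi(x;v)=[v_1(x+1)]^{v_2}\exp\{v_3[v_1(x+1)+1]\},$$ $$\mathbf v_1(i)=\Big(\tfrac{R_M}{2d_0},\ \beta_i+\tfrac{\alpha\mu\delta}{2},\ \tfrac{\alpha}{2}\kappa\mu d_0\Big),\qquad \mathbf v_2=\Big(\tfrac{R_M}{2d_0},\ \tfrac{\alpha\delta}{2},\ \tfrac{\alpha}{2}\kappa d_0\Big).$$ Let $x_1,\dots,x_N$ and $w_1,\dots,w_N$ be the nodes (roots of the $N$-th Legendre polynomial) and weights of the $N$-point Gauss–Legendre rule on $[-1,1]$. The Fox H-function is $$\mathrm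 H^{m',n'}_{p,q}\left[z\,\middle|\begin{array}{c}(a_j,A_j)\\(b_j,B_j)\end{array}\right]=\frac1{2\pi i}\int_L\frac{\prod_{j\le m'}\Gamma(b_j+B_js)\prod_{j\le n'}\Gamma(1-a_j-A_js)}{\prod_{j>m'}\Gamma(1-b_j-B_js)\prod_{j>n'}\Gamma(a_j+A_js)}z^{-s}\,ds,$$ $L$ being a vertical line that separates the poles of the two products in the numerator. The $N$-point quadrature form of the distribution function of $\Gamma$ is $$F_{\Gamma,N}(\gamma)=\frac{4R_Mc_1c_2^{-(\mu+m)}}{\alpha d_0\Gamma(\mu+m)}\Big(\frac{\gamma}{\gamma_0}\Big)^{\frac{\alpha\mu}2}\sum_{i=1}^{l}\sum_{k=1}^{N}B_i\Big(\frac{d_0}{R_M}\Big)^{\beta_i+1}w_k\Phi(x_k;\mathbf v_1(i))$$ $$\times\mathrm H^{3,2}_{4,4}\left[\frac{\Phi(x_k;\mathbf v_2)}{c_2}\Big(\frac{\gamma}{\gamma_0}\Big)^{\frac\alpha2}\middle|\begin{array}{c}(1-\mu-m,1),(1-\mu,1),(1+\beta-\alpha\mu,\alpha),(1+\beta-\alpha\mu,\alpha)\\(0,1),(\beta-\alpha\mu,\alpha),(\beta-\alpha\mu,\alpha),(-\mu,1)\end{array}\right].$$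 **Theorem.** Let $$S_N=\frac{2aR_Mc_1c_2^{-(\mu+m)}}{\sqrt\pi\,\alpha d_0\Gamma(\mu+m)}\Big(\frac{\gamma_0b}2\Big)^{-\frac{\alpha\mu}2}\sum_{i=1}^{l}\sum_{k=1}^{N}B_i\Big(\frac{d_0}{R_M}\Big)^{\beta_i+1}w_k\Phi(x_k;\mathbf v_1(i))$$ $$\times\mathrm H^{3,3}_{5,4}\left[\frac{\Phi(x_k;\mathbf v_2)}{c_2(\frac b2\gamma_0)^{\alpha/2}}\middle|\begin{array}{c}(1-\mu-m,1),(1-\mu,1),(\frac12-\frac{\alpha\mu}2,\frac\alpha2),(1+\beta-\alpha\mu,\alpha),(1+\beta-\alpha\mu,\alpha)\\(0,1),(\beta-\alpha\mu,\alpha),(\beta-\alpha\mu,\alpha),(-\mu,1)\end{array}\right].$$ 1. The two Fox H-functions are well defined for every argument $z>0$: a separating vertical line exists, and along every such line the integral converges absolutely, with the same value. 2. For every $N$ the integral $P_s[F_{\Gamma,N}]$ converges absolutely and $P_s[F_{\Gamma,N}]=S_N$. 3. The integral $P_s[F_\Gamma]$ converges absolutely and $S_N\to P_s[F_\Gamma]$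 as $N\to\infty$; that is, $S_N$ is the Gauss–Legendre approximation of the average symbol error probability of the model. -/

import Mathlib

open MeasureTheory ProbabilityTheory Filter Topology

namespace THz

noncomputable section

/-! ### The Fox H-function -/

/-- The Mellin-Barnes kernel
`∏_{j ≤ m} Γ(b_j + B_j s) ∏_{j ≤ n} Γ(1 - a_j - A_j s) /
  (∏_{j > m} Γ(1 - b_j - B_j s) ∏_{j > n} Γ(a_j + A_j s))`,
for the upper pairs `u j = (a_j, A_j)` and the lower pairs `v j = (b_j, B_j)`. -/
def foxKernel (m n : ℕ) {p q : ℕ} (u : Fin p → ℝ × ℝ) (v : Fin q → ℝ × ℝ) (s : ℂ) : ℂ :=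
  (∏ j : Fin q, if (j : ℕ) < m then Complex.Gamma ((v j).1 + (v j).2 * s)
      else (Complex.Gamma (1 - (v j).1 - (v j).2 * s))⁻¹) *
    ∏ j : Fin p, if (j : ℕ) < n then Complex.Gamma (1 - (u j).1 - (u j).2 * s)
      else (Complex.Gamma ((u j).1 + (u j).2 * s))⁻¹

/-- The vertical line `Re s = c` separates the poles `-(b_j + k) / B_j` (`j ≤ m`), which lie to
its left, from the poles `(1 - a_j + k) / A_j` (`j ≤ n`), which lie to its right. -/
def FoxSeparates (m n : ℕ) {p q : ℕ} (u : Fin p → ℝ × ℝ) (v : Fin q → ℝ × ℝ) (c : ℝ) : Prop :=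
  (∀ j : Fin q, (j : ℕ) < m → ∀ k : ℕ, -((v j).1 + k) / (v j).2 < c) ∧
    ∀ j : Fin p, (j : ℕ) < n → ∀ k : ℕ, c < (1 - (u j).1 + k) / (u j).2

open Classical in
/-- The Fox H-function `H^{m,n}_{p,q}[z | u ; v]` with real pairs (`A_j, B_j > 0`) and `z > 0`:
`(2πi)⁻¹ ∫_L foxKernel(s) z^{-s} ds` along a vertical line `L` that separates the two families of
poles. -/
def foxH (m n : ℕ) {p q : ℕ} (u : Fin p → ℝ × ℝ) (v : Fin q → ℝ × ℝ) (z : ℝ) : ℂ :=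
  if h : ∃ c : ℝ, FoxSeparates m n u v c then mellinInv h.choose (foxKernel m n u v) z else 0

/-- The Mellin-Barnes integral that defines `H^{m,n}_{p,q}[z | u ; v]` is meaningful: there is a
separating vertical line, along every such line the integral converges absolutely, and its value
is the same for all of them. -/
def FoxWellDefined (m n : ℕ) {p q : ℕ} (u : Fin p → ℝ × ℝ) (v : Fin q → ℝ × ℝ) (z : ℝ) : Prop :=
  (∃ c : ℝ, FoxSeparates m n u v c) ∧
    ∀ c : ℝ, FoxSeparates m n u v c →
      Complex.VerticalIntegrable
          (fun s : ℂ => (z : ℂ) ^ (-s) * foxKernel m n u v s) c ∧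
        mellinInv c (foxKernel m n u v) z = foxH m n u v z

/-! ### Gauss-Legendre quadrature on `[-1, 1]` -/

/-- The Legendre polynomial of degree `N` (Rodrigues' formula). -/
def legendre (N : ℕ) : Polynomial ℝ :=
  Polynomial.C (1 / (2 ^ N * (N.factorial : ℝ))) *
    Polynomial.derivative^[N] ((Polynomial.X ^ 2 - 1) ^ N)

/-- The nodes `x_1, …, x_N`: the roots of the Legendre polynomial of degree `N`. -/
def glNodes (N : ℕ) : Finset ℝ := (legendre N).roots.toFinset

/-- The weight of the node `x`: the integral over `[-1, 1]` of the Lagrange basis polynomial that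
is `1` at `x` and `0` at the other nodes. -/
def glWeight (N : ℕ) (x : ℝ) : ℝ :=
  ∫ t in (-1 : ℝ)..1, (Lagrange.basis (glNodes N) id x).eval t

/-! ### The channel model -/

/-- Density of the power `H_p ^ 2` of the pointing error. -/
def pointingPDF (β z : ℝ) : ℝ :=
  if 0 < z ∧ z < 1 then -(β ^ 2 / 4) * Real.log z * z ^ (β / 2 - 1) else 0

/-- Density of the power `H_f ^ 2` of `α-F` fading, with power parameter `Ωf`. -/
def alphaFPDF (α μ m lam Ωf x : ℝ) : ℝ :=
  if 0 < x then
    α / (2 * ProbabilityTheory.beta μ m) *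
      ((m - 1) * Ωf ^ (α / 2) / (lam ^ (α / 2) * μ)) ^ m *
      x ^ (α * μ / 2 - 1) *
      (x ^ (α / 2) + (m - 1) * Ωf ^ (α / 2) / (lam ^ (α / 2) * μ)) ^ (-(m + μ))
  else 0

/-- Density of the normalized distance `D` in the random waypoint model, where `ν i` is the
exponent that belongs to the coefficient `B i`. -/
def rwpPDF (d₀ RM : ℝ) {l : ℕ} (B ν : Fin l → ℝ) (d : ℝ) : ℝ :=
  if 1 < d ∧ d < 1 + RM / d₀ then
    ∑ i, B i * (d₀ / RM) ^ (ν i + 1) * (d - 1) ^ ν i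
  else 0

/-- The instantaneous SNR at normalized distance `d`. -/
def snr (γ₀ δ κ d₀ d hp hf : ℝ) : ℝ :=
  γ₀ * (d - 1) ^ (-δ) * Real.exp (-(κ * d₀ * d)) * hp ^ 2 * hf ^ 2

/-- The average symbol error probability that belongs to the distribution function `F` of the
SNR, for a binary constellation with parameters `(a, b)`. -/
def asep (a b : ℝ) (F : ℝ → ℂ) : ℂ :=
  ((a * √b / (2 * √(2 * Real.pi)) : ℝ) : ℂ) *
    ∫ γ in Set.Ioi (0 : ℝ), ((γ ^ (-(1 / 2) : ℝ) : ℝ) : ℂ) * F γ *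
      ((Real.exp (-(b / 2) * γ) : ℝ) : ℂ)

/-! ### The constants and the quadrature form of the distribution function -/

def c₁ (α μ β m lam : ℝ) : ℝ :=
  β ^ 2 * α / (8 * ProbabilityTheory.beta μ m) *
    ((m - 1) * (β + 2) ^ α / (β ^ α * lam ^ (α / 2) * μ)) ^ m

def c₂ (α μ β m lam : ℝ) : ℝ :=
  (m - 1) * (β + 2) ^ α / (lam ^ (α / 2) * μ * β ^ α)

def Phi (x : ℝ) (a : Fin 3 → ℝ) : ℝ :=
  (a 0 * (x + 1)) ^ a 1 * Real.exp (a 2 * (a 0 * (x + 1) + 1))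

/-- The vector `v₁(i)`, where `νi` is the `i`-th random waypoint exponent. -/
def v₁ (α μ δ κ d₀ RM νi : ℝ) : Fin 3 → ℝ :=
  ![RM / (2 * d₀), νi + α * μ * δ / 2, α / 2 * κ * μ * d₀]

def v₂ (α δ κ d₀ RM : ℝ) : Fin 3 → ℝ :=
  ![RM / (2 * d₀), α * δ / 2, α / 2 * κ * d₀]

/-- Upper pairs of the `H^{3,2}_{4,4}` in the distribution function. -/
def cdfUpper (α μ β m : ℝ) : Fin 4 → ℝ × ℝ :=
  ![(1 - μ - m, 1), (1 - μ, 1), (1 + β - α * μ, α), (1 + β - α * μ, α)]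

/-- Upper pairs of the `H^{3,3}_{5,4}` in the average symbol error probability. -/
def asepUpper (α μ β m : ℝ) : Fin 5 → ℝ × ℝ :=
  ![(1 - μ - m, 1), (1 - μ, 1), (1 / 2 - α * μ / 2, α / 2), (1 + β - α * μ, α),
    (1 + β - α * μ, α)]

/-- Lower pairs, common to both. -/
def foxLower (α μ β : ℝ) : Fin 4 → ℝ × ℝ :=
  ![(0, 1), (β - α * μ, α), (β - α * μ, α), (-μ, 1)]

/-- The distribution function of the SNR in its closed form, the average over the distance being
evaluated by the Gauss-Legendre rule with `N` nodes. -/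
def quadCDF (α μ β m lam δ γ₀ κ d₀ RM : ℝ) {l : ℕ} (B ν : Fin l → ℝ) (N : ℕ) (γ : ℝ) : ℂ :=
  ((4 * RM * c₁ α μ β m lam * c₂ α μ β m lam ^ (-(μ + m)) / (α * d₀ * Real.Gamma (μ + m)) *
      (γ / γ₀) ^ (α * μ / 2) : ℝ) : ℂ) *
    ∑ i, ∑ x ∈ glNodes N,
      ((B i * (d₀ / RM) ^ (ν i + 1) * glWeight N x * Phi x (v₁ α μ δ κ d₀ RM (ν i)) : ℝ) : ℂ) *
        foxH 3 2 (cdfUpper α μ β m) (foxLower α μ β)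
          (Phi x (v₂ α δ κ d₀ RM) / c₂ α μ β m lam * (γ / γ₀) ^ (α / 2))

/-- The closed form of the average symbol error probability with `N` Gauss-Legendre nodes. -/
def asepClosed (α μ β m lam δ γ₀ κ d₀ RM a b : ℝ) {l : ℕ} (B ν : Fin l → ℝ) (N : ℕ) : ℂ :=
  ((2 * a * RM * c₁ α μ β m lam * c₂ α μ β m lam ^ (-(μ + m)) /
        (√Real.pi * α * d₀ * Real.Gamma (μ + m)) *
      (γ₀ * b / 2) ^ (-(α * μ / 2)) : ℝ) : ℂ) *
    ∑ i, ∑ x ∈ glNodes N,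
      ((B i * (d₀ / RM) ^ (ν i + 1) * glWeight N x * Phi x (v₁ α μ δ κ d₀ RM (ν i)) : ℝ) : ℂ) *
        foxH 3 3 (asepUpper α μ β m) (foxLower α μ β)
          (Phi x (v₂ α δ κ d₀ RM) / (c₂ α μ β m lam * (b / 2 * γ₀) ^ (α / 2)))

end

end THz

open THz

/-!
The power `U V` of the channel, with `U = Hp ^ 2` due to pointing and `V = Hf ^ 2` to fading,
has explicit complex moments: those of `U` are rational (`hasMellin_pointingPDF`), those of `V` are
a quotient of Gamma functions (`hasMellin_alphaFPDF`, from Euler's beta integral on the half-line).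
Writing the Mellin transform of the distribution function `F` of `U V` as an expectation
(`hasMellin_measureReal_le`) shows that the kernel of `H^{3,2}_{4,4}`, which the functional equation
of `Γ` reduces to `Γ(s) Γ(μ + m - s) / ((β - α μ + α s) ^ 2 (μ - s))`, is the Mellin transform of
`x ^ (-μ) F((c₂ x) ^ (2 / α))`, up to a constant (`hasMellin_foxFun`); the normalization of the
power is what identifies the scale `c₂`.

On a vertical line the Gamma factors are bounded and the kernel is `O(|s| ^ (-2))`, so Mellin
inversion applies. It evaluates the Mellin-Barnes integral along every separating line, since `F` is
continuous, and thereby shows that the H-function is well defined and is `F` up to a power factor. The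
kernel of `H^{3,3}_{5,4}` has one more factor `Γ(1 / 2 + α μ / 2 - α s / 2)`, which Fubini's theorem
and Euler's integral for `Γ` produce from the integral over the SNR
(`integral_rpow_exp_mellinInv`); hence that H-function does not depend on the line either, and the
closed form is the error probability of the quadrature form, term by term (`integral_quadCDF`).

Consequently the quadrature form of the distribution function is the Gauss-Legendre sum of a
continuous function on `[-1, 1]` (`quadCDF_eq`) whose integral is the distribution function of the
SNR (`measureReal_snr_le`). Gauss-Legendre sums of continuous functions converge
(`tendsto_sum_glWeight_mul`): the weights are nonnegative, the rule is exact on polynomials, and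
polynomials are dense. All these sums are bounded by one constant, so dominated convergence carries
the limit through the average over the SNR.
-/

/-! ### Gauss-Legendre quadrature -/

namespace THz

open Polynomial

/-- The polynomial `(X ^ 2 - 1) ^ N`, whose `N`-th derivative is a multiple of `legendre N`, has
zeros of order `N` at the end points, which survive fewer than `N` differentiations. -/
lemma eval_iterate_derivative_eq_zero {N k : ℕ} (hk : k < N) {x : ℝ} (hx : x ^ 2 = 1) :
    (derivative^[k] ((X ^ 2 - 1 : ℝ[X]) ^ N)).eval x = 0 := by
  have h := pow_sub_dvd_iterate_derivative_pow (X ^ 2 - 1 : ℝ[X]) N k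
  have h2 : (X ^ 2 - 1 : ℝ[X]) ∣ derivative^[k] ((X ^ 2 - 1 : ℝ[X]) ^ N) :=
    (dvd_pow_self _ (by omega)).trans h
  refine eval_eq_zero_of_dvd_of_eval_eq_zero h2 ?_
  simp [hx]

/-- Rolle's theorem, applied `k` times: the `k`-th derivative of `(X ^ 2 - 1) ^ N` has zeros
`g 1 < ⋯ < g k` strictly between `g 0 = -1` and `g (k + 1) = 1`. -/
lemma exists_zeros_iterate_derivative (N k : ℕ) (hk : k ≤ N) :
    ∃ g : ℕ → ℝ, g 0 = -1 ∧ g (k + 1) = 1 ∧ (∀ i ≤ k, g i < g (i + 1)) ∧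
      ∀ i, 1 ≤ i → i ≤ k → (derivative^[k] ((X ^ 2 - 1 : ℝ[X]) ^ N)).eval (g i) = 0 := by
  induction k with
  | zero =>
    refine ⟨fun i => if i = 0 then -1 else 1, by simp, by simp, fun i hi => ?_,
      fun i h1 h2 => by omega⟩
    obtain rfl : i = 0 := by omega
    simp
  | succ k ih =>
    obtain ⟨g, g0, g1, gm, gz⟩ := ih (by omega)
    have hz : ∀ i ≤ k + 1, (derivative^[k] ((X ^ 2 - 1 : ℝ[X]) ^ N)).eval (g i) = 0 := by
      intro i hi
      rcases Nat.eq_zero_or_pos i with rfl | h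
      · exact eval_iterate_derivative_eq_zero (by omega) (by rw [g0]; norm_num)
      · rcases Nat.lt_or_ge k i with h' | h'
        · obtain rfl : i = k + 1 := by omega
          exact eval_iterate_derivative_eq_zero (by omega) (by rw [g1]; norm_num)
        · exact gz i h h'
    have hr : ∀ i, ∃ c, i ≤ k → c ∈ Set.Ioo (g i) (g (i + 1)) ∧
        (derivative^[k + 1] ((X ^ 2 - 1 : ℝ[X]) ^ N)).eval c = 0 := by
      intro i
      by_cases hi : i ≤ k
      · obtain ⟨c, hc, hc'⟩ := exists_hasDerivAt_eq_zero (gm i hi)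
          (derivative^[k] ((X ^ 2 - 1 : ℝ[X]) ^ N)).continuousOn
          ((hz i (by omega)).trans (hz (i + 1) (by omega)).symm)
          (fun x _ => (derivative^[k] ((X ^ 2 - 1 : ℝ[X]) ^ N)).hasDerivAt x)
        refine ⟨c, fun _ => ⟨hc, ?_⟩⟩
        rwa [Function.iterate_succ_apply']
      · exact ⟨0, fun h => absurd h hi⟩
    choose h hh using hr
    refine ⟨fun i => if i = 0 then -1 else if i = k + 2 then 1 else h (i - 1), by simp, by simp,
      fun i hi => ?_, fun i h1 h2 => ?_⟩
    · rcases Nat.eq_zero_or_pos i with rfl | hpos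
      · have := (hh 0 (by omega)).1.1
        simpa [g0] using this
      · have h1 : i ≠ 0 := by omega
        have h2 : i ≠ k + 2 := by omega
        have a1 := (hh (i - 1) (by omega)).1.2
        rw [Nat.sub_add_cancel hpos] at a1
        by_cases h3 : i = k + 1
        · subst h3
          simpa [g1] using a1
        · have a2 := (hh i (by omega)).1.1
          simpa [h1, h2, h3] using a1.trans a2
    · have e1 : i ≠ 0 := by omega
      have e2 : i ≠ k + 2 := by omega
      simpa [e1, e2] using (hh (i - 1) (by omega)).2

lemma legendre_ne_zero (N : ℕ) : legendre N ≠ 0 := by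
  have hm : ((X ^ 2 - 1 : ℝ[X]) ^ N).Monic := by monicity!
  have hd : ((X ^ 2 - 1 : ℝ[X]) ^ N).natDegree = N + N := by
    rw [natDegree_pow, show (X ^ 2 - 1 : ℝ[X]) = X ^ 2 - C 1 by simp, natDegree_X_pow_sub_C]
    ring
  intro h
  have hc := congrArg (fun p => coeff p N) h
  simp only [legendre, coeff_C_mul, coeff_iterate_derivative, coeff_zero] at hc
  rw [← hd, hm.coeff_natDegree, hd] at hc
  have h2 : ((N + N).descFactorial N : ℝ) ≠ 0 := by
    have : (N + N).descFactorial N ≠ 0 := by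
      rw [Ne, Nat.descFactorial_eq_zero_iff_lt]; omega
    exact_mod_cast this
  simp [h2, Nat.factorial_ne_zero] at hc

lemma natDegree_legendre_le (N : ℕ) : (legendre N).natDegree ≤ N := by
  have hd : ((X ^ 2 - 1 : ℝ[X]) ^ N).natDegree = N + N := by
    rw [natDegree_pow, show (X ^ 2 - 1 : ℝ[X]) = X ^ 2 - C 1 by simp, natDegree_X_pow_sub_C]
    ring
  refine (natDegree_C_mul_le _ _).trans ((natDegree_iterate_derivative _ _).trans ?_)
  omega

/-- Rolle's theorem gives `N` zeros in `(-1, 1)`, and the degree allows no more. -/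
lemma card_glNodes_and_mem_Ioo (N : ℕ) :
    (glNodes N).card = N ∧ ∀ x ∈ glNodes N, x ∈ Set.Ioo (-1 : ℝ) 1 := by
  obtain ⟨g, g0, g1, gm, gz⟩ := exists_zeros_iterate_derivative N N le_rfl
  have mono : ∀ j i, i < j → j ≤ N + 1 → g i < g j := by
    intro j
    induction j with
    | zero => intro i h; omega
    | succ j ih =>
      intro i h hj
      rcases Nat.lt_succ_iff_lt_or_eq.1 h with h' | rfl
      · exact (ih i h' (by omega)).trans (gm j (by omega))
      · exact gm i (by omega)
  have hinj : Set.InjOn g (Finset.Icc 1 N) := by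
    intro i hi j hj hij
    simp only [Finset.coe_Icc, Set.mem_Icc] at hi hj
    by_contra hne
    rcases Nat.lt_or_gt_of_ne hne with h | h
    · exact (mono j i h (by omega)).ne hij
    · exact (mono i j h (by omega)).ne' hij
  have hsub : (Finset.Icc 1 N).image g ⊆ glNodes N := by
    intro x hx
    obtain ⟨i, hi, rfl⟩ := Finset.mem_image.1 hx
    rw [Finset.mem_Icc] at hi
    rw [glNodes, Multiset.mem_toFinset, mem_roots (legendre_ne_zero N), IsRoot, legendre,
      eval_mul, gz i hi.1 hi.2, mul_zero]
  have hcard : ((Finset.Icc 1 N).image g).card = N := by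
    rw [Finset.card_image_of_injOn hinj]; simp
  have hle : (glNodes N).card ≤ N :=
    (Multiset.toFinset_card_le _).trans ((card_roots' _).trans (natDegree_legendre_le N))
  have heq := Finset.eq_of_subset_of_card_le hsub (by omega)
  rw [← heq]
  refine ⟨hcard, fun x hx => ?_⟩
  obtain ⟨i, hi, rfl⟩ := Finset.mem_image.1 hx
  rw [Finset.mem_Icc] at hi
  exact ⟨g0 ▸ mono i 0 (by omega) (by omega), g1 ▸ mono (N + 1) i (by omega) (by omega)⟩

lemma card_glNodes (N : ℕ) : (glNodes N).card = N := (card_glNodes_and_mem_Ioo N).1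

lemma mem_Ioo_of_mem_glNodes {N : ℕ} {x : ℝ} (hx : x ∈ glNodes N) : x ∈ Set.Ioo (-1 : ℝ) 1 :=
  (card_glNodes_and_mem_Ioo N).2 x hx

lemma eval_legendre_of_mem_glNodes {N : ℕ} {x : ℝ} (hx : x ∈ glNodes N) :
    (legendre N).eval x = 0 := by
  rw [glNodes, Multiset.mem_toFinset, mem_roots (legendre_ne_zero N)] at hx
  exact hx

lemma intervalIntegrable_eval (p : ℝ[X]) (a b : ℝ) :
    IntervalIntegrable (fun t => p.eval t) volume a b := p.continuous.intervalIntegrable a b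

/-- Integration by parts `k` times; the boundary terms vanish. -/
lemma integral_iterate_derivative_mul (N k : ℕ) (hk : k ≤ N) (q : ℝ[X]) :
    ∫ t in (-1 : ℝ)..1, (derivative^[k] ((X ^ 2 - 1 : ℝ[X]) ^ N) * q).eval t =
      (-1) ^ k * ∫ t in (-1 : ℝ)..1, ((X ^ 2 - 1 : ℝ[X]) ^ N * derivative^[k] q).eval t := by
  induction k generalizing q with
  | zero => simp
  | succ k ih =>
    have h := intervalIntegral.integral_mul_deriv_eq_deriv_mul (a := -1) (b := 1)
      (u := fun t => q.eval t)
      (v := fun t => (derivative^[k] ((X ^ 2 - 1 : ℝ[X]) ^ N)).eval t)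
      (fun x _ => q.hasDerivAt x)
      (fun x _ => (derivative^[k] ((X ^ 2 - 1 : ℝ[X]) ^ N)).hasDerivAt x)
      (intervalIntegrable_eval _ _ _) (intervalIntegrable_eval _ _ _)
    rw [eval_iterate_derivative_eq_zero (by omega) (by norm_num),
      eval_iterate_derivative_eq_zero (by omega) (by norm_num)] at h
    have e1 : ∀ t, (derivative^[k + 1] ((X ^ 2 - 1 : ℝ[X]) ^ N) * q).eval t =
        q.eval t * (derivative (derivative^[k] ((X ^ 2 - 1 : ℝ[X]) ^ N))).eval t := by
      intro t
      rw [Function.iterate_succ_apply', eval_mul, mul_comm]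
    have e2 := ih (by omega) (derivative q)
    simp only [e1, h, mul_zero, sub_self, zero_sub]
    rw [Function.iterate_succ_apply, pow_succ (-1 : ℝ) k, mul_neg_one, neg_mul, ← e2]
    simp only [eval_mul, mul_comm]

/-- The Legendre polynomial of degree `N` is orthogonal to all polynomials of smaller degree. -/
lemma integral_legendre_mul {N : ℕ} {q : ℝ[X]} (hq : q.natDegree < N) :
    ∫ t in (-1 : ℝ)..1, (legendre N * q).eval t = 0 := by
  have h := integral_iterate_derivative_mul N N le_rfl q
  rw [iterate_derivative_eq_zero hq] at h
  simp only [mul_zero, eval_zero, intervalIntegral.integral_zero] at h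
  have e : ∀ t, (legendre N * q).eval t = 1 / (2 ^ N * (N.factorial : ℝ)) *
      (derivative^[N] ((X ^ 2 - 1 : ℝ[X]) ^ N) * q).eval t := by
    intro t
    simp [legendre, eval_mul, mul_assoc]
  simp only [e, intervalIntegral.integral_const_mul, h, mul_zero]

/-- A polynomial of degree less than `N` is its own interpolation polynomial at the `N` nodes, so
the rule is exact on it. -/
lemma sum_glWeight_mul_eval_of_degree_lt {N : ℕ} {p : ℝ[X]} (hp : p.degree < N) :
    ∑ x ∈ glNodes N, glWeight N x * p.eval x = ∫ t in (-1 : ℝ)..1, p.eval t := by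
  have hinj : Set.InjOn (id : ℝ → ℝ) (glNodes N) := Function.injective_id.injOn
  have h : p = ∑ x ∈ glNodes N, C (p.eval x) * Lagrange.basis (glNodes N) id x := by
    have := Lagrange.eq_interpolate (f := p) hinj (by rwa [card_glNodes])
    rw [Lagrange.interpolate_apply] at this
    simpa using this
  have h2 : ∀ t, p.eval t =
      ∑ x ∈ glNodes N, p.eval x * (Lagrange.basis (glNodes N) id x).eval t := by
    intro t
    conv_lhs => rw [h]
    simp [eval_finsetSum]
  rw [intervalIntegral.integral_congr (fun t _ => h2 t),
    intervalIntegral.integral_finsetSum (fun x _ => (intervalIntegrable_eval _ _ _).const_mul _)]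
  refine Finset.sum_congr rfl fun x _ => ?_
  rw [intervalIntegral.integral_const_mul, glWeight, mul_comm]

/-- The rule with `N` nodes is exact up to degree `2 N - 1`: division by the Legendre polynomial
leaves a remainder on which the rule is exact, and a multiple of the Legendre polynomial that
contributes to neither side. -/
lemma sum_glWeight_mul_eval {N : ℕ} {p : ℝ[X]} (hp : p.natDegree < 2 * N) :
    ∑ x ∈ glNodes N, glWeight N x * p.eval x = ∫ t in (-1 : ℝ)..1, p.eval t := by
  have hL := legendre_ne_zero N
  have hdeg : (legendre N).natDegree = N := by
    refine le_antisymm (natDegree_legendre_le N) ?_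
    conv_lhs => rw [← card_glNodes N]
    exact (Multiset.toFinset_card_le _).trans (card_roots' _)
  have hsplit := EuclideanDomain.div_add_mod p (legendre N)
  have hr : (p % legendre N).degree < N := by
    have := EuclideanDomain.mod_lt p hL
    have h2 : (legendre N).degree = N := by rw [degree_eq_natDegree hL, hdeg]
    rw [← h2]; exact this
  have hq : (p / legendre N).natDegree < N := by
    rcases lt_or_ge p.degree (legendre N).degree with hlt | hge
    · rw [(Polynomial.div_eq_zero_iff hL).2 hlt, natDegree_zero]
      omega
    · have hp0 : p ≠ 0 := by
        rintro rfl
        exact hL (degree_eq_bot.1 (by simpa using hge))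
      have hadd := Polynomial.degree_add_div hL hge
      rw [degree_eq_natDegree hL, degree_eq_natDegree hp0, hdeg, degree_eq_natDegree
        (fun h => not_lt.2 hge ((Polynomial.div_eq_zero_iff hL).1 h))] at hadd
      have : N + (p / legendre N).natDegree = p.natDegree := by exact_mod_cast hadd
      omega
  have e : ∀ t, p.eval t = (legendre N * (p / legendre N)).eval t + (p % legendre N).eval t := by
    intro t
    rw [← eval_add, hsplit]
  simp_rw [e]
  rw [intervalIntegral.integral_add (intervalIntegrable_eval _ _ _) (intervalIntegrable_eval _ _ _),
    integral_legendre_mul hq, zero_add, ← sum_glWeight_mul_eval_of_degree_lt hr]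
  refine Finset.sum_congr rfl fun x hx => ?_
  rw [eval_mul, eval_legendre_of_mem_glNodes hx]
  ring

/-- The weights are nonnegative: `w_x` is the integral of the square of the Lagrange basis
polynomial at `x`. -/
lemma glWeight_nonneg {N : ℕ} {x : ℝ} (hx : x ∈ glNodes N) : 0 ≤ glWeight N x := by
  have hinj : Set.InjOn (id : ℝ → ℝ) (glNodes N) := Function.injective_id.injOn
  have hN : 0 < N := by
    rw [← card_glNodes N]; exact Finset.card_pos.2 ⟨x, hx⟩
  have hd : ((Lagrange.basis (glNodes N) id x) ^ 2).natDegree < 2 * N := by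
    rw [natDegree_pow, Lagrange.natDegree_basis hinj hx, card_glNodes]; omega
  have h := sum_glWeight_mul_eval hd
  rw [Finset.sum_eq_single x] at h
  · have h1 := Lagrange.eval_basis_self hinj hx
    simp only [id] at h1
    rw [eval_pow, h1, one_pow, mul_one] at h
    rw [h]
    refine intervalIntegral.integral_nonneg (by norm_num) fun t _ => ?_
    rw [eval_pow]; positivity
  · intro y hy hyx
    have h1 := Lagrange.eval_basis_of_ne (v := (id : ℝ → ℝ)) hyx.symm hy
    simp only [id] at h1
    rw [eval_pow, h1]; simp
  · exact fun h => absurd hx h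

lemma sum_glWeight_le (N : ℕ) : ∑ x ∈ glNodes N, glWeight N x ≤ 2 := by
  rcases Nat.eq_zero_or_pos N with rfl | hN
  · have : glNodes 0 = ∅ := Finset.card_eq_zero.1 (card_glNodes 0)
    simp [this]
  · have := sum_glWeight_mul_eval (N := N) (p := 1) (by simpa using hN)
    simp only [eval_one, mul_one, intervalIntegral.integral_const, smul_eq_mul] at this
    rw [this]; norm_num

/-- The Gauss-Legendre rule converges for every continuous function: Weierstrass approximation,
with exactness on polynomials and nonnegativity of the weights. -/
theorem tendsto_sum_glWeight_mul {f : ℝ → ℝ} (hf : ContinuousOn f (Set.Icc (-1) 1)) :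
    Tendsto (fun N => ∑ x ∈ glNodes N, glWeight N x * f x) atTop
      (𝓝 (∫ t in (-1 : ℝ)..1, f t)) := by
  rw [Metric.tendsto_atTop]
  intro ε hε
  obtain ⟨p, hp⟩ := exists_polynomial_near_of_continuousOn (-1) 1 f hf (ε / 5) (by positivity)
  refine ⟨p.natDegree + 1, fun N hN => ?_⟩
  have hex := sum_glWeight_mul_eval (N := N) (p := p) (by omega)
  have h1 : |∑ x ∈ glNodes N, glWeight N x * f x - ∑ x ∈ glNodes N, glWeight N x * p.eval x|
      ≤ 2 * (ε / 5) := by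
    rw [← Finset.sum_sub_distrib]
    refine (Finset.abs_sum_le_sum_abs _ _).trans ?_
    calc ∑ x ∈ glNodes N, |glWeight N x * f x - glWeight N x * p.eval x|
        ≤ ∑ x ∈ glNodes N, glWeight N x * (ε / 5) := by
          refine Finset.sum_le_sum fun x hx => ?_
          have hw := glWeight_nonneg hx
          rw [← mul_sub, abs_mul, abs_of_nonneg hw, abs_sub_comm]
          exact mul_le_mul_of_nonneg_left
            (hp x (Set.Ioo_subset_Icc_self (mem_Ioo_of_mem_glNodes hx))).le hw
      _ = (∑ x ∈ glNodes N, glWeight N x) * (ε / 5) := by rw [Finset.sum_mul]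
      _ ≤ 2 * (ε / 5) := mul_le_mul_of_nonneg_right (sum_glWeight_le N) (by positivity)
  have hfi : IntervalIntegrable f volume (-1) 1 :=
    ContinuousOn.intervalIntegrable (by rwa [Set.uIcc_of_le (by norm_num)])
  have h2 : |(∫ t in (-1 : ℝ)..1, p.eval t) - ∫ t in (-1 : ℝ)..1, f t| ≤ 2 * (ε / 5) := by
    rw [← intervalIntegral.integral_sub (intervalIntegrable_eval _ _ _) hfi]
    have := intervalIntegral.norm_integral_le_of_norm_le_const (a := -1) (b := 1)
      (f := fun t => p.eval t - f t) (C := ε / 5) (fun t ht => by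
        rw [Set.uIoc_of_le (by norm_num)] at ht
        exact (hp t (Set.Ioc_subset_Icc_self ht)).le)
    rw [Real.norm_eq_abs] at this
    refine this.trans (le_of_eq ?_)
    norm_num; ring
  rw [Real.dist_eq]
  rw [hex] at h1
  have h3 := abs_sub_le (∑ x ∈ glNodes N, glWeight N x * f x) (∫ t in (-1 : ℝ)..1, p.eval t)
    (∫ t in (-1 : ℝ)..1, f t)
  linarith

end THz

/-! ### Mellin transforms of the densities -/

namespace THz

open Complex Set

lemma cpow_ofReal_rpow {x : ℝ} (hx : 0 < x) (a : ℝ) (s : ℂ) :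
    ((x ^ a : ℝ) : ℂ) ^ s = (x : ℂ) ^ ((a : ℂ) * s) := by
  have hx0 : (x : ℂ) ≠ 0 := by exact_mod_cast hx.ne'
  rw [cpow_def_of_ne_zero hx0,
    cpow_def_of_ne_zero (by exact_mod_cast (Real.rpow_pos_of_pos hx _).ne'), ← ofReal_log hx.le,
    ← ofReal_log (Real.rpow_pos_of_pos hx _).le, Real.log_rpow hx]
  congr 1
  push_cast; ring

lemma image_div_one_add : (fun x : ℝ => x / (1 + x)) '' Ioi 0 = Ioo 0 1 := by
  ext y
  simp only [mem_image, mem_Ioi, mem_Ioo]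
  constructor
  · rintro ⟨x, hx, rfl⟩
    have : 0 < 1 + x := by linarith
    exact ⟨by positivity, by rw [div_lt_one this]; linarith⟩
  · rintro ⟨h0, h1⟩
    have : 0 < 1 - y := by linarith
    exact ⟨y / (1 - y), by positivity, by field_simp; ring⟩

/-- Euler's beta integral in the form `∫ x ^ (s - 1) (1 + x) ^ (-A) dx = Γ(s) Γ(A - s) / Γ(A)`
over the positive half-line: the substitution `u = x / (1 + x)`. -/
lemma hasMellin_one_add_rpow {A : ℝ} {s : ℂ} (hs : 0 < s.re) (hA : s.re < A) :
    HasMellin (fun x : ℝ => (((1 + x) ^ (-A) : ℝ) : ℂ)) s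
      (Gamma s * Gamma (A - s) / Gamma A) := by
  have hd : ∀ x ∈ Ioi (0 : ℝ),
      HasDerivWithinAt (fun x : ℝ => x / (1 + x)) (1 / (1 + x) ^ 2) (Ioi 0) x := by
    intro x hx
    have hx' : 1 + x ≠ 0 := by have : 0 < x := hx; positivity
    have := ((hasDerivAt_id x).div ((hasDerivAt_id x).const_add 1) hx').hasDerivWithinAt
      (s := Ioi 0)
    refine this.congr_deriv ?_
    simp only [id_eq]
    ring
  have hinj : InjOn (fun x : ℝ => x / (1 + x)) (Ioi 0) := by
    intro x hx y hy hxy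
    have hx' : 0 < x := hx
    have hy' : 0 < y := hy
    have : x * (1 + y) = y * (1 + x) := by
      have : x / (1 + x) = y / (1 + y) := hxy
      rwa [div_eq_div_iff (by positivity) (by positivity)] at this
    linarith
  set F : ℝ → ℂ := fun x => (x : ℂ) ^ (s - 1) * (1 - (x : ℂ)) ^ ((A : ℂ) - s - 1) with hF
  have hconv : IntegrableOn F (Ioo 0 1) := by
    have := betaIntegral_convergent hs (v := (A : ℂ) - s) (by simpa using hA)
    rw [intervalIntegrable_iff_integrableOn_Ioo_of_le (by norm_num)] at this
    exact this
  have hval : ∫ x in Ioo (0 : ℝ) 1, F x = Gamma s * Gamma (A - s) / Gamma A := by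
    have h1 := Gamma_mul_Gamma_eq_betaIntegral hs (t := (A : ℂ) - s) (by simpa using hA)
    rw [betaIntegral, intervalIntegral.integral_of_le (by norm_num),
      integral_Ioc_eq_integral_Ioo, add_sub_cancel] at h1
    have hne : Gamma (A : ℂ) ≠ 0 := by
      refine Gamma_ne_zero_of_re_pos ?_
      rw [ofReal_re]; linarith
    rw [h1, mul_div_cancel_left₀ _ hne]
  have hcongr : ∀ x ∈ Ioi (0 : ℝ), |1 / (1 + x) ^ 2| • F (x / (1 + x)) =
      (x : ℂ) ^ (s - 1) • (((1 + x) ^ (-A) : ℝ) : ℂ) := by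
    intro x hx
    have hx0 : 0 < x := hx
    have h1x : 0 < 1 + x := by linarith
    have hc : ((1 + x : ℝ) : ℂ) ≠ 0 := by exact_mod_cast h1x.ne'
    have e1 : (1 - ((x / (1 + x) : ℝ) : ℂ)) = (((1 + x)⁻¹ : ℝ) : ℂ) := by
      rw [← ofReal_one, ← ofReal_sub]; congr 1; field_simp; ring
    have e2 : ((x / (1 + x) : ℝ) : ℂ) = (x : ℂ) * (((1 + x)⁻¹ : ℝ) : ℂ) := by
      rw [← ofReal_mul, div_eq_mul_inv]
    rw [abs_of_pos (by positivity), hF]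
    simp only [real_smul, smul_eq_mul]
    rw [e1, e2, mul_cpow_ofReal_nonneg hx0.le (by positivity), mul_assoc,
      ← cpow_add _ _ (by exact_mod_cast (inv_pos.2 h1x).ne'), ofReal_cpow h1x.le,
      mul_left_comm]
    congr 1
    rw [show s - 1 + (↑A - s - 1) = (A : ℂ) - 2 by ring, ofReal_inv, inv_cpow, ← cpow_neg]
    · rw [show ((1 / (1 + x) ^ 2 : ℝ) : ℂ) = ((1 + x : ℝ) : ℂ) ^ (-2 : ℂ) by
        rw [cpow_neg, show (2 : ℂ) = ((2 : ℕ) : ℂ) by norm_num, cpow_natCast]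
        push_cast; rw [one_div], ← cpow_add _ _ hc]
      congr 1
      push_cast; ring
    · rw [arg_ofReal_of_nonneg h1x.le]; exact Real.pi_pos.ne
  constructor
  · rw [MellinConvergent, ← integrableOn_congr_fun hcongr measurableSet_Ioi,
      ← integrableOn_image_iff_integrableOn_abs_deriv_smul measurableSet_Ioi hd hinj,
      image_div_one_add]
    exact hconv
  · rw [mellin, ← setIntegral_congr_fun measurableSet_Ioi hcongr,
      ← integral_image_eq_integral_abs_deriv_smul measurableSet_Ioi hd hinj, image_div_one_add,
      hval]

/-- The Mellin transform of `log` on `(0, 1]` is the derivative `-1 / s ^ 2` of that of `1`. -/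
lemma hasMellin_log_Ioc {s : ℂ} (hs : 0 < s.re) :
    HasMellin (fun t : ℝ => Real.log t • (Ioc (0 : ℝ) 1).indicator (fun _ => (1 : ℂ)) t) s
      (-1 / s ^ 2) := by
  have h := mellin_hasDerivAt_of_isBigO_rpow (a := s.re + 1) (b := 0) (s := s)
    (f := (Ioc (0 : ℝ) 1).indicator (fun _ => (1 : ℂ)))
    (by
      refine (Integrable.locallyIntegrable ?_).locallyIntegrableOn _
      rw [integrable_indicator_iff measurableSet_Ioc]
      exact integrableOn_const (by simp))
    (by
      refine (Asymptotics.isBigO_zero _ _).congr' ?_ (EventuallyEq.refl _ _)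
      filter_upwards [eventually_gt_atTop (1 : ℝ)] with t ht
      rw [indicator_of_notMem]
      exact fun h => absurd h.2 (not_le.2 ht))
    (by linarith)
    (by
      simp only [neg_zero, Real.rpow_zero]
      refine Asymptotics.IsBigO.of_bound 1 (Eventually.of_forall fun t => ?_)
      refine (norm_indicator_le_norm_self _ _).trans ?_
      simp)
    hs
  refine ⟨h.1, h.2.unique ?_⟩
  have hs0 : s ≠ 0 := by rintro rfl; simp at hs
  have hd := (hasDerivAt_inv hs0)
  have : mellin ((Ioc (0 : ℝ) 1).indicator (fun _ => (1 : ℂ))) =ᶠ[𝓝 s] fun s => s⁻¹ := by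
    have ho : IsOpen {z : ℂ | 0 < z.re} := isOpen_lt continuous_const continuous_re
    filter_upwards [ho.mem_nhds hs] with z hz
    rw [(hasMellin_one_Ioc hz).2, one_div]
  rw [neg_div, one_div]
  exact hd.congr_of_eventuallyEq this

/-- `∫ z ^ r` against the density of the pointing error power is
`(β ^ 2 / 4) / (β / 2 + r) ^ 2`. -/
lemma hasMellin_pointingPDF {β : ℝ} {r : ℂ} (hr : 0 < β / 2 + r.re) :
    HasMellin (fun z : ℝ => (pointingPDF β z : ℂ)) (r + 1)
      ((β : ℂ) ^ 2 / 4 / ((β : ℂ) / 2 + r) ^ 2) := by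
  have h := hasMellin_log_Ioc (s := r + 1 + ((β / 2 - 1 : ℝ) : ℂ)) (by
    simp only [add_re, one_re, ofReal_re]; linarith)
  obtain ⟨h1, h2⟩ := h
  rw [← MellinConvergent.cpow_smul] at h1
  rw [← mellin_cpow_smul] at h2
  have h3 := hasMellin_const_smul h1 (-((β : ℂ) ^ 2 / 4))
  have hcongr : ∀ t ∈ Ioi (0 : ℝ), t ≠ 1 →
      -((β : ℂ) ^ 2 / 4) • (t : ℂ) ^ ((β / 2 - 1 : ℝ) : ℂ) •
      (Real.log t • (Ioc (0 : ℝ) 1).indicator (fun _ => (1 : ℂ)) t) = (pointingPDF β t : ℂ) := by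
    intro t ht ht1
    have ht0 : 0 < t := ht
    by_cases hlt : t < 1
    · rw [indicator_of_mem (show t ∈ Ioc (0 : ℝ) 1 from ⟨ht0, hlt.le⟩), pointingPDF,
        if_pos ⟨ht0, hlt⟩]
      push_cast [ofReal_cpow ht0.le]
      simp only [smul_eq_mul, real_smul, mul_one]
      ring
    · rw [indicator_of_notMem (fun h => hlt (lt_of_le_of_ne h.2 ht1)), pointingPDF,
        if_neg (fun h => hlt h.2)]
      simp
  have hae : ∀ᵐ t : ℝ ∂(volume.restrict (Ioi (0 : ℝ))),
      (t : ℂ) ^ (r + 1 - 1) • (-((β : ℂ) ^ 2 / 4) • (t : ℂ) ^ ((β / 2 - 1 : ℝ) : ℂ) •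
      (Real.log t • (Ioc (0 : ℝ) 1).indicator (fun _ => (1 : ℂ)) t)) =
      (t : ℂ) ^ (r + 1 - 1) • (pointingPDF β t : ℂ) := by
    filter_upwards [ae_restrict_mem measurableSet_Ioi,
      ae_restrict_of_ae (Measure.ae_ne volume (1 : ℝ))] with t ht ht1
    rw [hcongr t ht ht1]
  refine ⟨h3.1.congr hae, ?_⟩
  rw [mellin, ← integral_congr_ae hae]
  have h4 := h3.2
  rw [mellin, h2] at h4
  rw [h4, smul_eq_mul]
  push_cast
  rw [show r + 1 + ((β : ℂ) / 2 - 1) = (β : ℂ) / 2 + r by ring]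
  ring

/-- `∫ x ^ r` against the `α-F` density with scale `K` is
`K ^ (2 r / α) Γ(μ + 2 r / α) Γ(m - 2 r / α) / (Γ(μ) Γ(m))`. -/
lemma hasMellin_alphaFPDF {α μ m lam Ωf K : ℝ} (hα : 0 < α) (hμ : 0 < μ) (hm : 0 < m)
    (hK : K = (m - 1) * Ωf ^ (α / 2) / (lam ^ (α / 2) * μ)) (hK0 : 0 < K) {q : ℂ}
    (h0 : 0 < μ + q.re) (h1 : q.re < m) :
    HasMellin (fun x : ℝ => (alphaFPDF α μ m lam Ωf x : ℂ)) (α / 2 * q + 1)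
      ((K : ℂ) ^ q * (Gamma (μ + q) * Gamma (m - q)) / (Gamma μ * Gamma m)) := by
  have hA := hasMellin_one_add_rpow (A := m + μ) (s := μ + q) (by simpa using h0)
    (by simp only [add_re, ofReal_re]; linarith)
  have hKi : 0 < K⁻¹ := inv_pos.2 hK0
  have hα2 : α / 2 ≠ 0 := by positivity
  have hαc : (α : ℂ) ≠ 0 := by exact_mod_cast hα.ne'
  have hs : (α / 2 * q + 1 + ((α * μ / 2 - 1 : ℝ) : ℂ)) / ((α / 2 : ℝ) : ℂ) = μ + q := by
    push_cast; field_simp; ring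
  have c1 := (MellinConvergent.comp_mul_left hKi).2 hA.1
  have m1 := mellin_comp_mul_left (fun x : ℝ => (((1 + x) ^ (-(m + μ)) : ℝ) : ℂ)) (μ + q) hKi
  rw [← hs] at c1
  have c2 := (MellinConvergent.comp_rpow hα2).2 c1
  have m2 := mellin_comp_rpow (fun x : ℝ => (((1 + K⁻¹ * x) ^ (-(m + μ)) : ℝ) : ℂ))
    (α / 2 * q + 1 + ((α * μ / 2 - 1 : ℝ) : ℂ)) (α / 2)
  rw [hs, m1, hA.2] at m2
  rw [← MellinConvergent.cpow_smul] at c2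
  rw [← mellin_cpow_smul] at m2
  have h3 := hasMellin_const_smul c2
    ((α / (2 * ProbabilityTheory.beta μ m) * K ^ m * K ^ (-(m + μ)) : ℝ) : ℂ)
  rw [m2] at h3
  have hcongr : ∀ t ∈ Ioi (0 : ℝ),
      (t : ℂ) ^ (α / 2 * q + 1 - 1) •
      (((α / (2 * ProbabilityTheory.beta μ m) * K ^ m * K ^ (-(m + μ)) : ℝ) : ℂ) •
        (t : ℂ) ^ ((α * μ / 2 - 1 : ℝ) : ℂ) •
          (((1 + K⁻¹ * t ^ (α / 2)) ^ (-(m + μ)) : ℝ) : ℂ)) =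
      (t : ℂ) ^ (α / 2 * q + 1 - 1) • (alphaFPDF α μ m lam Ωf t : ℂ) := by
    intro t ht
    have ht0 : 0 < t := ht
    congr 1
    have ht2 : 0 < t ^ (α / 2) := Real.rpow_pos_of_pos ht0 _
    rw [alphaFPDF, if_pos ht0, ← hK, show t ^ (α / 2) + K = K * (1 + K⁻¹ * t ^ (α / 2)) by
      field_simp; ring, Real.mul_rpow hK0.le (by positivity), ← ofReal_cpow ht0.le]
    simp only [smul_eq_mul]
    push_cast
    ring
  constructor
  · exact h3.1.congr_fun hcongr measurableSet_Ioi
  · rw [mellin, ← setIntegral_congr_fun measurableSet_Ioi hcongr]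
    have h4 := h3.2
    rw [mellin] at h4
    rw [h4]
    have hKc : (K : ℂ) ≠ 0 := by exact_mod_cast hK0.ne'
    have hG1 : Gamma (μ : ℂ) ≠ 0 := Gamma_ne_zero_of_re_pos (by simpa using hμ)
    have hG2 : Gamma (m : ℂ) ≠ 0 := Gamma_ne_zero_of_re_pos (by simpa using hm)
    have hG3 : Gamma ((m : ℂ) + μ) ≠ 0 := Gamma_ne_zero_of_re_pos (by simp; linarith)
    have hB : ((ProbabilityTheory.beta μ m : ℝ) : ℂ) = Gamma μ * Gamma m / Gamma (m + μ) := by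
      rw [ProbabilityTheory.beta]
      rw [add_comm μ m]
      push_cast
      rw [← Gamma_ofReal, ← Gamma_ofReal, ← Gamma_ofReal]
      push_cast
      rfl
    have hinv : ((K⁻¹ : ℝ) : ℂ) ^ (-((μ : ℂ) + q)) = (K : ℂ) ^ ((μ : ℂ) + q) := by
      rw [ofReal_inv, inv_cpow, cpow_neg, inv_inv]
      rw [arg_ofReal_of_nonneg hK0.le]; exact Real.pi_pos.ne
    have hKK : (K : ℂ) ^ (m : ℂ) * (K : ℂ) ^ (-((m : ℂ) + μ)) * (K : ℂ) ^ ((μ : ℂ) + q) =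
        (K : ℂ) ^ q := by
      rw [← cpow_add _ _ hKc, ← cpow_add _ _ hKc]; congr 1; ring
    rw [hinv, abs_of_pos (by positivity), ← hKK]
    simp only [smul_eq_mul, real_smul]
    push_cast [ofReal_cpow hK0.le]
    rw [hB, show (m : ℂ) + μ - (μ + q) = m - q by ring]
    field_simp

/-- Moments of a positive random variable with a density are values of the Mellin transform of
that density. -/
lemma integrable_and_integral_cpow_of_law {Ω : Type*} [MeasurableSpace Ω] {P : Measure Ω}
    {X : Ω → ℝ} (hX : Measurable X) {f : ℝ → ℝ} (hf : Measurable f)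
    (hf0 : ∀ x, 0 < x → 0 ≤ f x) (hf' : ∀ x ≤ 0, f x = 0)
    (hlaw : P.map X = volume.withDensity (fun x => ENNReal.ofReal (f x))) {r M : ℂ}
    (hM : HasMellin (fun x => (f x : ℂ)) (r + 1) M) :
    Integrable (fun ω => (X ω : ℂ) ^ r) P ∧ ∫ ω, (X ω : ℂ) ^ r ∂P = M := by
  have hg : Measurable (fun x : ℝ => (x : ℂ) ^ r) := by fun_prop
  have hpos : ∀ x, 0 ≤ f x := fun x => by
    rcases le_or_gt x 0 with h | h
    · exact (hf' x h).ge
    · exact hf0 x h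
  have hind : (fun x : ℝ => (ENNReal.ofReal (f x)).toReal • (x : ℂ) ^ r) =
      (Ioi (0 : ℝ)).indicator (fun x : ℝ => (x : ℂ) ^ (r + 1 - 1) • (f x : ℂ)) := by
    ext x
    rw [ENNReal.toReal_ofReal (hpos x)]
    by_cases hx : x ∈ Ioi (0 : ℝ)
    · rw [indicator_of_mem hx, add_sub_cancel_right, real_smul, smul_eq_mul, mul_comm]
    · rw [indicator_of_notMem hx, hf' x (not_lt.1 hx), zero_smul]
  have hmap : Integrable (fun x : ℝ => (x : ℂ) ^ r) (P.map X) := by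
    rw [hlaw, integrable_withDensity_iff_integrable_smul' hf.ennreal_ofReal
      (Eventually.of_forall fun x => ENNReal.ofReal_lt_top), hind,
      integrable_indicator_iff measurableSet_Ioi]
    exact hM.1
  refine ⟨(integrable_map_measure hg.aestronglyMeasurable hX.aemeasurable).1 hmap, ?_⟩
  rw [← integral_map hX.aemeasurable hg.aestronglyMeasurable (f := fun x : ℝ => (x : ℂ) ^ r), hlaw,
    integral_withDensity_eq_integral_toReal_smul hf.ennreal_ofReal
      (Eventually.of_forall fun x => ENNReal.ofReal_lt_top), hind,
    integral_indicator measurableSet_Ioi]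
  exact hM.2

end THz

/-! ### The Mellin-Barnes integrals -/

namespace THz

open Complex Set

lemma norm_Gamma_le {s : ℂ} (hs : 0 < s.re) : ‖Gamma s‖ ≤ Real.Gamma s.re := by
  rw [Gamma_eq_integral hs, GammaIntegral, Real.Gamma_eq_integral hs]
  refine (norm_integral_le_integral_norm _).trans (le_of_eq ?_)
  refine setIntegral_congr_fun measurableSet_Ioi fun x hx => ?_
  have hx0 : 0 < x := hx
  simp only [norm_mul, norm_real, Real.norm_eq_abs, abs_of_pos (Real.exp_pos _)]
  rw [norm_cpow_eq_rpow_re_of_pos hx0]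
  simp

/-- The abscissas `c` of the separating lines, for both H-functions: the largest pole on the left
is `0` or `μ - β / α`, the smallest one on the right is `μ`. -/
def InStrip (α μ β c : ℝ) : Prop := 0 < c ∧ 0 < β - α * μ + α * c ∧ c < μ

lemma exists_inStrip {α μ β : ℝ} (hα : 0 < α) (hμ : 0 < μ) (hβ : 0 < β) :
    ∃ c, InStrip α μ β c := by
  have h : max 0 (μ - β / α) < μ := max_lt hμ (by have := div_pos hβ hα; linarith)
  obtain ⟨c, h1, h2⟩ := exists_between h
  refine ⟨c, (le_max_left _ _).trans_lt h1, ?_, h2⟩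
  have h3 := mul_lt_mul_of_pos_left ((le_max_right _ _).trans_lt h1) hα
  rw [mul_sub, mul_div_cancel₀ _ hα.ne'] at h3
  linarith

lemma left_separates_iff {α μ β : ℝ} (hα : 0 < α) (c : ℝ) :
    (∀ j : Fin 4, (j : ℕ) < 3 → ∀ k : ℕ,
      -((foxLower α μ β j).1 + k) / (foxLower α μ β j).2 < c) ↔
      0 < c ∧ 0 < β - α * μ + α * c := by
  constructor
  · intro h
    have h0 := h 0 (by decide) 0
    have h1 := h 1 (by decide) 0
    simp only [foxLower, Matrix.cons_val] at h0 h1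
    rw [div_lt_iff₀ hα] at h1
    constructor
    · simpa using h0
    · push_cast at h1; linarith
  · rintro ⟨h0, h1⟩ j hj k
    have hk : (0 : ℝ) ≤ k := k.cast_nonneg
    fin_cases j
    · simp only [foxLower, Matrix.cons_val, Fin.zero_eta]
      rw [div_one]; linarith
    · simp only [foxLower, Matrix.cons_val, Fin.mk_one]
      rw [div_lt_iff₀ hα]; linarith
    · simp only [foxLower, Matrix.cons_val, Fin.reduceFinMk]
      rw [div_lt_iff₀ hα]; linarith
    · simp at hj

lemma foxSeparates_cdf_iff {α μ β m : ℝ} (hα : 0 < α) (hm : 0 < m) (c : ℝ) :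
    FoxSeparates 3 2 (cdfUpper α μ β m) (foxLower α μ β) c ↔ InStrip α μ β c := by
  rw [FoxSeparates, left_separates_iff hα, InStrip, ← and_assoc]
  refine and_congr_right fun _ => ⟨fun h => ?_, fun h j hj k => ?_⟩
  · have := h 1 (by decide) 0
    simp only [cdfUpper, Matrix.cons_val] at this
    simpa using this
  · have hk : (0 : ℝ) ≤ k := k.cast_nonneg
    fin_cases j
    · simp only [cdfUpper, Matrix.cons_val, Fin.zero_eta]
      rw [div_one]; linarith
    · simp only [cdfUpper, Matrix.cons_val, Fin.mk_one]
      rw [div_one]; linarith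
    · simp at hj
    · simp at hj

lemma foxSeparates_asep_iff {α μ β m : ℝ} (hα : 0 < α) (hm : 0 < m) (c : ℝ) :
    FoxSeparates 3 3 (asepUpper α μ β m) (foxLower α μ β) c ↔ InStrip α μ β c := by
  rw [FoxSeparates, left_separates_iff hα, InStrip, ← and_assoc]
  refine and_congr_right fun _ => ⟨fun h => ?_, fun h j hj k => ?_⟩
  · have := h 1 (by decide) 0
    simp only [asepUpper, Matrix.cons_val] at this
    simpa using this
  · have hk : (0 : ℝ) ≤ k := k.cast_nonneg
    fin_cases j
    · simp only [asepUpper, Matrix.cons_val, Fin.zero_eta]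
      rw [div_one]; linarith
    · simp only [asepUpper, Matrix.cons_val, Fin.mk_one]
      rw [div_one]; linarith
    · simp only [asepUpper, Matrix.cons_val, Fin.reduceFinMk]
      rw [lt_div_iff₀ (by positivity)]
      have := mul_lt_mul_of_pos_left h hα
      linarith
    · simp at hj
    · simp at hj

/-- On the strip the functional equation of `Γ` turns the kernel of the distribution function into
`Γ(s) Γ(μ + m - s) / ((β - α μ + α s) ^ 2 (μ - s))`. -/
lemma foxKernel_cdf {α μ β m : ℝ} {s : ℂ} (hs : InStrip α μ β s.re) :
    foxKernel 3 2 (cdfUpper α μ β m) (foxLower α μ β) s =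
      Gamma s * Gamma (μ + m - s) / ((β - α * μ + α * s) ^ 2 * (μ - s)) := by
  obtain ⟨h0, h1, h2⟩ := hs
  have hp : 0 < ((β : ℂ) - α * μ + α * s).re := by
    simpa [add_re, sub_re, mul_re] using h1
  have hq : 0 < ((μ : ℂ) - s).re := by simpa using h2
  have hp0 : ((β : ℂ) - α * μ + α * s) ≠ 0 := fun h => by rw [h] at hp; simp at hp
  have hq0 : ((μ : ℂ) - s) ≠ 0 := fun h => by rw [h] at hq; simp at hq
  have hgp := Gamma_ne_zero_of_re_pos hp
  have hgq := Gamma_ne_zero_of_re_pos hq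
  simp only [foxKernel, Fin.prod_univ_four, cdfUpper, foxLower, Matrix.cons_val]
  norm_num
  rw [show (1 : ℂ) + β - α * μ + α * s = (β - α * μ + α * s) + 1 by ring, Gamma_add_one _ hp0,
    show (1 : ℂ) + μ - s = (μ - s) + 1 by ring, Gamma_add_one _ hq0,
    show (1 : ℂ) - (1 - μ - m) - s = μ + m - s by ring]
  field_simp

/-- The kernel of the error probability has one more Gamma factor. -/
lemma foxKernel_asep {α μ β m : ℝ} (s : ℂ) :
    foxKernel 3 3 (asepUpper α μ β m) (foxLower α μ β) s =
      foxKernel 3 2 (cdfUpper α μ β m) (foxLower α μ β) s *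
        Gamma (((1 / 2 + α * μ / 2 : ℝ) : ℂ) - α / 2 * s) := by
  simp only [foxKernel, Fin.prod_univ_four, Fin.prod_univ_five, cdfUpper, asepUpper, foxLower,
    Matrix.cons_val]
  norm_num
  rw [show (1 : ℂ) - (1 / 2 - α * μ / 2) - α / 2 * s = 1 / 2 + α * μ / 2 - α / 2 * s by ring]
  ring

lemma re_line (c y : ℝ) : ((c : ℂ) + y * I).re = c := by simp

lemma continuous_Gamma_comp {f : ℝ → ℂ} (hf : Continuous f) (h : ∀ y, 0 < (f y).re) :
    Continuous fun y => Gamma (f y) := by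
  refine continuous_iff_continuousAt.2 fun y => ?_
  refine ContinuousAt.comp (g := Gamma) ?_ hf.continuousAt
  refine (differentiableAt_Gamma _ fun k hk => ?_).continuousAt
  have := h y
  rw [hk] at this
  simp at this
  have hk0 : (0 : ℝ) ≤ k := k.cast_nonneg
  linarith

/-- The kernel of the distribution function decays along vertical lines at least like
`|s| ^ (-2)`, because the Gamma factors are bounded there. -/
lemma verticalIntegrable_cdf {α μ β m c : ℝ} (hα : 0 < α) (hm : 0 < m)
    (hc : InStrip α μ β c) :
    VerticalIntegrable (foxKernel 3 2 (cdfUpper α μ β m) (foxLower α μ β)) c := by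
  have hre := fun y : ℝ => re_line c y
  obtain ⟨h0, h1, h2⟩ := id hc
  have hk : ∀ y : ℝ, foxKernel 3 2 (cdfUpper α μ β m) (foxLower α μ β) (c + y * I) =
      Gamma (c + y * I) * Gamma (μ + m - (c + y * I)) /
        ((β - α * μ + α * (c + y * I)) ^ 2 * (μ - (c + y * I))) := fun y =>
    foxKernel_cdf (by rwa [hre])
  set p := β - α * μ + α * c with hp
  have hpn : ∀ y : ℝ, ‖(β : ℂ) - α * μ + α * (c + y * I)‖ ^ 2 = p ^ 2 + (α * y) ^ 2 := by
    intro y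
    rw [show (β : ℂ) - α * μ + α * (c + y * I) = (p : ℂ) + (α * y : ℝ) * I by
      rw [hp]; push_cast; ring, Complex.sq_norm, normSq_add_mul_I]
  have hqn : ∀ y : ℝ, μ - c ≤ ‖(μ : ℂ) - (c + y * I)‖ := by
    intro y
    refine le_trans (le_of_eq ?_) (re_le_norm _)
    simp
  have hpp : ∀ y : ℝ, 0 < p ^ 2 + (α * y) ^ 2 := fun y => by positivity
  have hd1 : ∀ y : ℝ, (β : ℂ) - α * μ + α * (c + y * I) ≠ 0 := fun y h => by
    have h2 := hpn y
    rw [h, norm_zero] at h2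
    have := hpp y
    norm_num at h2
    linarith
  have hd2 : ∀ y : ℝ, (μ : ℂ) - (c + y * I) ≠ 0 := fun y h => by
    have := hqn y
    rw [h, norm_zero] at this
    linarith
  have hcont : Continuous fun y : ℝ => Gamma (c + y * I) * Gamma (μ + m - (c + y * I)) /
        ((β - α * μ + α * (c + y * I)) ^ 2 * (μ - (c + y * I))) := by
    refine Continuous.div₀ (Continuous.mul ?_ ?_) (by fun_prop)
      fun y => mul_ne_zero (pow_ne_zero _ (hd1 y)) (hd2 y)
    · exact continuous_Gamma_comp (by fun_prop) fun y => by rwa [hre]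
    · refine continuous_Gamma_comp (by fun_prop) fun y => ?_
      simp; linarith
  have hmin : 0 < min (p ^ 2) (α ^ 2) := lt_min (by positivity) (by positivity)
  unfold VerticalIntegrable
  simp only [hk]
  refine Integrable.mono' (integrable_inv_one_add_sq.const_mul
    (Real.Gamma c * Real.Gamma (μ + m - c) / (min (p ^ 2) (α ^ 2) * (μ - c))))
    hcont.aestronglyMeasurable (Eventually.of_forall fun y => ?_)
  have hg1 : ‖Gamma (c + y * I)‖ ≤ Real.Gamma c := by
    have := norm_Gamma_le (s := c + y * I) (by rwa [hre])
    rwa [hre] at this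
  have hg2 : ‖Gamma (μ + m - (c + y * I))‖ ≤ Real.Gamma (μ + m - c) := by
    have e : ((μ : ℂ) + m - (c + y * I)).re = μ + m - c := by simp
    have := norm_Gamma_le (s := (μ : ℂ) + m - (c + y * I)) (by rw [e]; linarith)
    rwa [e] at this
  have hG1 := Real.Gamma_pos_of_pos h0
  have hG2 := Real.Gamma_pos_of_pos (show 0 < μ + m - c by linarith)
  rw [norm_div, norm_mul, norm_mul, norm_pow, hpn, ← div_eq_mul_inv, div_div]
  have hlow : min (p ^ 2) (α ^ 2) * (1 + y ^ 2) ≤ p ^ 2 + (α * y) ^ 2 := by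
    rw [mul_add, mul_one, mul_pow]
    exact add_le_add (min_le_left _ _) (mul_le_mul_of_nonneg_right (min_le_right _ _) (sq_nonneg y))
  refine div_le_div₀ (by positivity) (mul_le_mul hg1 hg2 (norm_nonneg _) hG1.le)
    (mul_pos (mul_pos hmin (by linarith)) (by positivity)) ?_
  calc min (p ^ 2) (α ^ 2) * (μ - c) * (1 + y ^ 2)
      = min (p ^ 2) (α ^ 2) * (1 + y ^ 2) * (μ - c) := by ring
    _ ≤ _ := mul_le_mul hlow (hqn y) (by linarith) (hpp y).le

lemma re_asep_pos {α μ β c : ℝ} (hα : 0 < α) (hc : InStrip α μ β c) (y : ℝ) :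
    0 < (((1 / 2 + α * μ / 2 : ℝ) : ℂ) - α / 2 * (c + y * I)).re := by
  have e : (((1 / 2 + α * μ / 2 : ℝ) : ℂ) - α / 2 * (c + y * I)).re =
      1 / 2 + α / 2 * (μ - c) := by
    rw [show (((1 / 2 + α * μ / 2 : ℝ) : ℂ) - α / 2 * (c + y * I)) =
      ((1 / 2 + α / 2 * (μ - c) : ℝ) : ℂ) + ((-(α / 2 * y) : ℝ) : ℂ) * I by push_cast; ring]
    exact re_line _ _
  rw [e]
  have := hc.2.2
  have : 0 < α / 2 * (μ - c) := mul_pos (by positivity) (by linarith)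
  linarith

lemma verticalIntegrable_asep {α μ β m c : ℝ} (hα : 0 < α) (hm : 0 < m)
    (hc : InStrip α μ β c) :
    VerticalIntegrable (foxKernel 3 3 (asepUpper α μ β m) (foxLower α μ β)) c := by
  have hre := re_asep_pos hα hc
  have hcont : Continuous fun y : ℝ =>
      Gamma (((1 / 2 + α * μ / 2 : ℝ) : ℂ) - α / 2 * (c + y * I)) :=
    continuous_Gamma_comp (by fun_prop) hre
  unfold VerticalIntegrable
  simp only [foxKernel_asep]
  have e : ∀ y : ℝ, (((1 / 2 + α * μ / 2 : ℝ) : ℂ) - α / 2 * (c + y * I)).re =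
      (((1 / 2 + α * μ / 2 : ℝ) : ℂ) - α / 2 * (c + (0 : ℝ) * I)).re := fun y => by
    simp
  refine (verticalIntegrable_cdf hα hm hc).mul_bdd
    (c := Real.Gamma (((1 / 2 + α * μ / 2 : ℝ) : ℂ) - α / 2 * (c + (0 : ℝ) * I)).re)
    hcont.aestronglyMeasurable (Eventually.of_forall fun y => ?_)
  have := norm_Gamma_le (hre y)
  rwa [e y] at this

/-- The factor `z ^ (-s)` has constant modulus along a vertical line. -/
lemma verticalIntegrable_cpow_mul {k : ℂ → ℂ} {c z : ℝ} (hk : VerticalIntegrable k c)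
    (hz : 0 < z) : VerticalIntegrable (fun s : ℂ => (z : ℂ) ^ (-s) * k s) c := by
  have hz0 : (z : ℂ) ≠ 0 := by exact_mod_cast hz.ne'
  have hcont : Continuous fun y : ℝ => (z : ℂ) ^ (-((c : ℂ) + y * I)) :=
    Continuous.const_cpow (by fun_prop) (Or.inl hz0)
  refine Integrable.bdd_mul (c := z ^ (-c)) hk hcont.aestronglyMeasurable
    (Eventually.of_forall fun y => ?_)
  rw [norm_cpow_eq_rpow_re_of_pos hz]
  simp

/-- If the kernel is, on the separating lines, the Mellin transform of one function, then Mellin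
inversion shows that the Mellin-Barnes integral does not depend on the line. -/
lemma mellinInv_eq_of_mellin {k : ℂ → ℂ} {c x : ℝ} {G : ℝ → ℂ} (hx : 0 < x)
    (hk : VerticalIntegrable k c) (hG : ∀ y : ℝ, HasMellin G (c + y * I) (k (c + y * I)))
    (hcont : ContinuousAt G x) : mellinInv c k x = G x := by
  have hG0 : MellinConvergent G c := by simpa using (hG 0).1
  have hv : VerticalIntegrable (mellin G) c := by
    refine hk.congr (Eventually.of_forall fun y => ?_)
    exact (hG y).2.symm
  rw [← mellinInv_mellin_eq c G hx hG0 hv hcont]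
  simp only [mellinInv, (hG _).2]

lemma foxH_eq_of_forall {m n p q : ℕ} {u : Fin p → ℝ × ℝ} {v : Fin q → ℝ × ℝ} {z : ℝ} {H : ℂ}
    (hex : ∃ c, FoxSeparates m n u v c)
    (h : ∀ c, FoxSeparates m n u v c → mellinInv c (foxKernel m n u v) z = H) :
    foxH m n u v z = H := by
  rw [foxH, dif_pos hex]
  exact h _ hex.choose_spec

/-- The Laplace-type integral of a Mellin-Barnes integral inserts a Gamma factor into the kernel:
Fubini's theorem and Euler's integral
`∫ γ ^ (p - 1 - a s) e ^ (-r γ) dγ = Γ(p - a s) r ^ (a s - p)`. -/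
lemma integral_rpow_exp_mellinInv {k : ℂ → ℂ} {c p a r w : ℝ} (hk : VerticalIntegrable k c)
    (hr : 0 < r) (hw : 0 < w) (hpc : 0 < p - a * c) :
    IntegrableOn (fun γ : ℝ => ((γ ^ (p - 1) * Real.exp (-r * γ) : ℝ) : ℂ) *
        mellinInv c k (w * γ ^ a)) (Ioi 0) ∧
      ∫ γ in Ioi (0 : ℝ), ((γ ^ (p - 1) * Real.exp (-r * γ) : ℝ) : ℂ) *
        mellinInv c k (w * γ ^ a) =
      ((r ^ (-p) : ℝ) : ℂ) * mellinInv c (fun s => k s * Gamma (p - a * s)) (w * r ^ (-a)) := by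
  set F : ℝ × ℝ → ℂ := fun z => ((z.1 ^ (p - 1) * Real.exp (-r * z.1) : ℝ) : ℂ) *
    (((w * z.1 ^ a : ℝ) : ℂ) ^ (-((c : ℂ) + z.2 * I)) * k (c + z.2 * I)) with hF
  have hgam : IntegrableOn (fun γ : ℝ => γ ^ (p - a * c - 1) * Real.exp (-r * γ)) (Ioi 0) := by
    have h := integrableOn_rpow_mul_exp_neg_mul_rpow (p := 1) (s := p - a * c - 1) (b := r)
      (by linarith) (by norm_num) hr
    simpa using h
  have hint : Integrable F ((volume.restrict (Ioi (0 : ℝ))).prod volume) := by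
    have hdom := (hgam.mul_const (w ^ (-c))).mul_prod (f := fun γ : ℝ =>
      γ ^ (p - a * c - 1) * Real.exp (-r * γ) * w ^ (-c)) hk.norm
    refine Integrable.mono' hdom ?_ ?_
    · refine AEStronglyMeasurable.mul (Measurable.aestronglyMeasurable (by fun_prop))
        (AEStronglyMeasurable.mul (Measurable.aestronglyMeasurable (by fun_prop)) ?_)
      exact hk.aestronglyMeasurable.comp_snd
    · have hmem : ∀ᵐ z ∂((volume.restrict (Ioi (0 : ℝ))).prod (volume : Measure ℝ)),
          z.1 ∈ Ioi (0 : ℝ) := by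
        have := (Measure.quasiMeasurePreserving_fst (μ := volume.restrict (Ioi (0 : ℝ)))
          (ν := (volume : Measure ℝ))).ae (ae_restrict_mem measurableSet_Ioi)
        exact this
      filter_upwards [hmem] with z hz
      have hz0 : 0 < z.1 := hz
      have hwz : 0 < w * z.1 ^ a := mul_pos hw (Real.rpow_pos_of_pos hz0 _)
      simp only [hF, norm_mul, norm_real, Real.norm_eq_abs, abs_of_pos (Real.exp_pos _),
        abs_of_pos (Real.rpow_pos_of_pos hz0 _)]
      rw [norm_cpow_eq_rpow_re_of_pos hwz, neg_re, re_line,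
        Real.mul_rpow hw.le (Real.rpow_nonneg hz0.le _), ← Real.rpow_mul hz0.le,
        show p - a * c - 1 = (p - 1) + a * -c by ring, Real.rpow_add hz0]
      refine le_of_eq ?_
      ring
  have hinner : ∀ γ : ℝ, ((1 / (2 * Real.pi) : ℝ) : ℂ) * ∫ y, F (γ, y) =
      ((γ ^ (p - 1) * Real.exp (-r * γ) : ℝ) : ℂ) * mellinInv c k (w * γ ^ a) := by
    intro γ
    simp only [hF, mellinInv, smul_eq_mul, real_smul]
    rw [integral_const_mul]
    ring
  have houter : ∀ y : ℝ, ∫ γ in Ioi (0 : ℝ), F (γ, y) =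
      ((r ^ (-p) : ℝ) : ℂ) * (((w * r ^ (-a) : ℝ) : ℂ) ^ (-((c : ℂ) + y * I)) *
        (k (c + y * I) * Gamma (p - a * (c + y * I)))) := by
    intro y
    set s : ℂ := c + y * I with hs
    have hre : 0 < ((p : ℂ) - a * s).re := by
      simpa [hs] using hpc
    have h := integral_cpow_mul_exp_neg_mul_Ioi (r := r) hre (by simpa using hr)
    have hr0 : (r : ℂ) ≠ 0 := by exact_mod_cast hr.ne'
    have hinv : (1 / (r : ℂ)) ^ ((p : ℂ) - a * s) =
        ((r ^ (-p) : ℝ) : ℂ) * ((r ^ (-a) : ℝ) : ℂ) ^ (-s) := by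
      rw [one_div, inv_cpow, ← cpow_neg, ofReal_cpow hr.le, ofReal_cpow hr.le,
        show -((p : ℂ) - a * s) = ((-p : ℝ) : ℂ) + ((-a : ℝ) : ℂ) * -s by push_cast; ring,
        cpow_add _ _ hr0, ← ofReal_cpow hr.le (-a), ← ofReal_cpow hr.le (-p)]
      · rw [cpow_ofReal_rpow hr]
      · rw [arg_ofReal_of_nonneg hr.le]; exact Real.pi_pos.ne
    have hcongr : ∀ γ ∈ Ioi (0 : ℝ), F (γ, y) = ((w : ℂ) ^ (-s) * k s) *
        ((γ : ℂ) ^ ((p : ℂ) - a * s - 1) * exp (-((r : ℂ) * γ))) := by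
      intro γ hγ
      have hγ0 : 0 < γ := hγ
      have hγc : (γ : ℂ) ≠ 0 := by exact_mod_cast hγ0.ne'
      have hpow : ((γ ^ a : ℝ) : ℂ) ^ (-s) = (γ : ℂ) ^ (-(a * s)) := by
        rw [cpow_ofReal_rpow hγ0, mul_neg]
      simp only [hF, ← hs]
      rw [ofReal_mul, ofReal_mul, mul_cpow_ofReal_nonneg hw.le (Real.rpow_nonneg hγ0.le _), hpow,
        show (p : ℂ) - a * s - 1 = ((p - 1 : ℝ) : ℂ) + -(a * s) by push_cast; ring,
        cpow_add _ _ hγc, ofReal_cpow hγ0.le]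
      push_cast
      rw [neg_mul]
      ring
    rw [setIntegral_congr_fun measurableSet_Ioi hcongr, integral_const_mul, h, hinv, ofReal_mul w,
      mul_cpow_ofReal_nonneg hw.le (Real.rpow_nonneg hr.le _)]
    ring
  constructor
  · have := hint.integral_prod_left.const_mul ((1 / (2 * Real.pi) : ℝ) : ℂ)
    simp only [hinner] at this
    exact this
  · simp_rw [← hinner]
    rw [integral_const_mul, integral_integral_swap (f := fun γ y => F (γ, y)) hint]
    simp_rw [houter]
    rw [integral_const_mul]
    simp only [mellinInv, smul_eq_mul, real_smul]
    ring

end THz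

/-! ### The distribution function of the channel power -/

namespace THz

open Complex Set

section Probability

variable {Ω : Type*} [MeasurableSpace Ω] {P : Measure Ω}

lemma ae_gt_of_law {X : Ω → ℝ} (hX : Measurable X) {f : ℝ → ℝ} {a : ℝ}
    (hf' : ∀ x ≤ a, f x = 0)
    (hlaw : P.map X = volume.withDensity (fun x => ENNReal.ofReal (f x))) :
    ∀ᵐ ω ∂P, a < X ω := by
  have h : P.map X (Iic a) = 0 := by
    rw [hlaw, withDensity_apply _ measurableSet_Iic]
    refine (setLIntegral_congr_fun (g := fun _ => 0) measurableSet_Iic fun x hx => ?_).trans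
      (by simp)
    simp [hf' x hx]
  rw [Measure.map_apply hX measurableSet_Iic] at h
  filter_upwards [measure_eq_zero_iff_ae_notMem.1 h] with ω hω
  exact not_le.1 hω

lemma measurable_pointingPDF (β : ℝ) : Measurable (pointingPDF β) := by
  unfold pointingPDF
  exact Measurable.ite measurableSet_Ioo (by fun_prop) measurable_const

lemma measurable_alphaFPDF (α μ m lam Ωf : ℝ) : Measurable (alphaFPDF α μ m lam Ωf) := by
  unfold alphaFPDF
  exact Measurable.ite measurableSet_Ioi (by fun_prop) measurable_const

lemma pointingPDF_nonneg (β z : ℝ) : 0 ≤ pointingPDF β z := by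
  unfold pointingPDF
  split_ifs with h
  · have := Real.log_neg h.1 h.2
    have := Real.rpow_pos_of_pos h.1 (β / 2 - 1)
    have h3 : 0 ≤ -(β ^ 2 / 4) * Real.log z := mul_nonneg_of_nonpos_of_nonpos
      (by have := sq_nonneg β; linarith) (by linarith)
    positivity
  · exact le_rfl

lemma pointingPDF_of_nonpos (β : ℝ) {z : ℝ} (hz : z ≤ 0) : pointingPDF β z = 0 :=
  if_neg fun h => not_le.2 h.1 hz

lemma alphaFPDF_of_nonpos (α μ m lam Ωf : ℝ) {x : ℝ} (hx : x ≤ 0) :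
    alphaFPDF α μ m lam Ωf x = 0 :=
  if_neg fun h => not_le.2 h hx

lemma alphaFPDF_nonneg {α μ m lam Ωf : ℝ} (hα : 0 < α) (hμ : 0 < μ) (hm : 1 < m)
    (hlam : 0 < lam) (hΩf : 0 < Ωf) {x : ℝ} : 0 ≤ alphaFPDF α μ m lam Ωf x := by
  unfold alphaFPDF
  split_ifs with h
  · have := ProbabilityTheory.beta_pos hμ (show 0 < m by linarith)
    have hm1 : 0 < m - 1 := by linarith
    positivity
  · exact le_rfl

lemma c₂_pos {α μ β m lam : ℝ} (hμ : 0 < μ) (hβ : 0 < β) (hm : 1 < m) (hlam : 0 < lam) :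
    0 < c₂ α μ β m lam := by
  have hm1 : 0 < m - 1 := by linarith
  unfold c₂
  positivity

/-- The normalization of the total power identifies the scale of the fading with `c₂`, because
`E[U] = β ^ 2 / (β + 2) ^ 2`. -/
lemma c₂_eq_of_normalized {α μ β m lam Ωf : ℝ} (hβ : 0 < β) {U : Ω → ℝ} (hU : Measurable U)
    (hlawU : P.map U = volume.withDensity (fun z => ENNReal.ofReal (pointingPDF β z)))
    (hnorm : (∫ ω, U ω ∂P) * Ωf = 1) :
    c₂ α μ β m lam = (m - 1) * Ωf ^ (α / 2) / (lam ^ (α / 2) * μ) := by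
  have h := (integrable_and_integral_cpow_of_law hU (measurable_pointingPDF β)
    (fun x _ => pointingPDF_nonneg β x) (fun x hx => pointingPDF_of_nonpos β hx) hlawU
    (hasMellin_pointingPDF (β := β) (r := 1) (by simp; linarith))).2
  simp only [cpow_one] at h
  rw [show (∫ ω, (U ω : ℂ) ∂P) = ((∫ ω, U ω ∂P : ℝ) : ℂ) from integral_ofReal] at h
  have h2 : ∫ ω, U ω ∂P = β ^ 2 / 4 / (β / 2 + 1) ^ 2 := by exact_mod_cast h
  have hΩ : Ωf = ((β + 2) / β) ^ (2 : ℝ) := by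
    rw [h2] at hnorm
    rw [Real.rpow_two]
    field_simp at hnorm ⊢
    linarith
  rw [hΩ, ← Real.rpow_mul (by positivity), mul_div_cancel₀ _ (by norm_num : (2 : ℝ) ≠ 0),
    Real.div_rpow (by positivity) hβ.le, c₂]
  field_simp

variable [IsProbabilityMeasure P]

/-- The product of two independent positive random variables, one of which has a law without
atoms, has a law without atoms. -/
lemma measure_mul_eq_zero {U V : Ω → ℝ} (hU : Measurable U) (hV : Measurable V)
    (hUV : U ⟂ᵢ[P] V) (hUa : ∀ a, P.map U {a} = 0) (hV0 : ∀ᵐ ω ∂P, 0 < V ω) (y : ℝ) :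
    P.map (fun ω => U ω * V ω) {y} = 0 := by
  have := Measure.isProbabilityMeasure_map (μ := P) hU.aemeasurable
  have := Measure.isProbabilityMeasure_map (μ := P) hV.aemeasurable
  have hms : MeasurableSet {z : ℝ × ℝ | z.2 * z.1 = y} :=
    measurableSet_eq_fun (by fun_prop) (by fun_prop)
  have h1 : P.map (fun ω => U ω * V ω) {y} =
      P.map (fun ω => (V ω, U ω)) {z : ℝ × ℝ | z.2 * z.1 = y} := by
    rw [Measure.map_apply (f := fun ω => U ω * V ω) (hU.mul hV) (measurableSet_singleton y),
      Measure.map_apply (hV.prodMk hU) hms]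
    rfl
  rw [h1, (indepFun_iff_map_prod_eq_prod_map_map hV.aemeasurable hU.aemeasurable).1 hUV.symm,
    Measure.measure_prod_null hms]
  have hV1 : ∀ᵐ v ∂(P.map V), 0 < v :=
    (ae_map_iff hV.aemeasurable measurableSet_Ioi).2 hV0
  filter_upwards [hV1] with v hv
  have : Prod.mk v ⁻¹' {z : ℝ × ℝ | z.2 * z.1 = y} = {y / v} := by
    ext u
    simp only [mem_preimage, mem_ofPred_eq, mem_singleton_iff]
    rw [eq_div_iff hv.ne']
  rw [this, hUa]
  rfl

/-- A law without atoms has a continuous distribution function. -/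
lemma continuous_measureReal_le {W : Ω → ℝ} (hW : Measurable W) (ha : ∀ a, P.map W {a} = 0) :
    Continuous fun y => P.real {ω | W ω ≤ y} := by
  have := Measure.isProbabilityMeasure_map (μ := P) hW.aemeasurable
  have e : (fun y => P.real {ω | W ω ≤ y}) = cdf (P.map W) := by
    ext y
    rw [cdf_eq_real, map_measureReal_apply hW measurableSet_Iic]
    rfl
  rw [e]
  refine continuous_iff_continuousAt.2 fun y => ?_
  rw [(monotone_cdf _).continuousAt_iff_leftLim_eq_rightLim, StieltjesFunction.rightLim_eq]
  have h := (cdf (P.map W)).measure_singleton y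
  rw [measure_cdf, ha, eq_comm, ENNReal.ofReal_eq_zero] at h
  exact le_antisymm ((monotone_cdf _).leftLim_le le_rfl) (by linarith)

/-- The Mellin transform of a distribution function, to the left of the imaginary axis, is
`E[T ^ e] / (-e)`: exchange the expectation with `∫_T^∞ x ^ (e - 1) dx = T ^ e / (-e)`. -/
lemma hasMellin_measureReal_le {T : Ω → ℝ} (hT : Measurable T) (hT0 : ∀ᵐ ω ∂P, 0 < T ω) {e M : ℂ}
    (he : e.re < 0) (hi : Integrable (fun ω => (T ω : ℂ) ^ e) P)
    (hM : ∫ ω, (T ω : ℂ) ^ e ∂P = M) :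
    HasMellin (fun x => (P.real {ω | T ω ≤ x} : ℂ)) e (M / (-e)) := by
  set S : Set (ℝ × Ω) := {z | T z.2 ≤ z.1} with hS
  have hSm : MeasurableSet S := measurableSet_le (hT.comp measurable_snd) measurable_fst
  set F : ℝ × Ω → ℂ := S.indicator fun z => (z.1 : ℂ) ^ (e - 1) with hF
  have hFm : Measurable F := Measurable.indicator (by fun_prop) hSm
  have he1 : (e - 1).re < -1 := by rw [sub_re, one_re]; linarith
  have hsec : ∀ ω, (fun x => F (x, ω)) = (Ici (T ω)).indicator fun x : ℝ => (x : ℂ) ^ (e - 1) := by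
    intro ω; ext x
    by_cases h : T ω ≤ x
    · rw [indicator_of_mem (show x ∈ Ici (T ω) from h), hF,
        indicator_of_mem (show (x, ω) ∈ S from h)]
    · rw [indicator_of_notMem (show x ∉ Ici (T ω) from h), hF,
        indicator_of_notMem (show (x, ω) ∉ S from h)]
  have hinter : ∀ ω, 0 < T ω → Ici (T ω) ∩ Ioi 0 = Ici (T ω) := fun ω h =>
    inter_eq_left.2 fun x hx => lt_of_lt_of_le h hx
  have hint : Integrable F ((volume.restrict (Ioi (0 : ℝ))).prod P) := by
    rw [integrable_prod_iff' hFm.aestronglyMeasurable]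
    constructor
    · filter_upwards [hT0] with ω hω
      rw [hsec, integrable_indicator_iff measurableSet_Ici, IntegrableOn,
        Measure.restrict_restrict measurableSet_Ici, hinter ω hω, ← IntegrableOn,
        integrableOn_Ici_iff_integrableOn_Ioi]
      exact integrableOn_Ioi_cpow_of_lt he1 hω
    · refine (hi.norm.const_mul (-e.re)⁻¹).congr ?_
      filter_upwards [hT0] with ω hω
      have e1 : (fun x => ‖F (x, ω)‖) =
          (Ici (T ω)).indicator fun x : ℝ => ‖(x : ℂ) ^ (e - 1)‖ := by
        ext x
        rw [← norm_indicator_eq_indicator_norm, ← hsec]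
      rw [e1, integral_indicator measurableSet_Ici, Measure.restrict_restrict measurableSet_Ici,
        hinter ω hω, integral_Ici_eq_integral_Ioi,
        setIntegral_congr_fun (g := fun x : ℝ => x ^ (e.re - 1)) measurableSet_Ioi
          (fun x hx => by
            simp only
            rw [norm_cpow_eq_rpow_re_of_pos (lt_trans hω hx)]; simp),
        integral_Ioi_rpow_of_lt (by linarith) hω, norm_cpow_eq_rpow_re_of_pos hω,
        sub_add_cancel]
      rw [neg_div, ← div_neg, div_eq_inv_mul]
  have hin : ∀ x, ∫ ω, F (x, ω) ∂P = (x : ℂ) ^ (e - 1) • (P.real {ω | T ω ≤ x} : ℂ) := by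
    intro x
    have hm : MeasurableSet {ω | T ω ≤ x} := measurableSet_le hT measurable_const
    have e1 : (fun ω => F (x, ω)) = {ω | T ω ≤ x}.indicator fun _ => (x : ℂ) ^ (e - 1) := by
      ext ω
      by_cases h : T ω ≤ x
      · rw [indicator_of_mem (show ω ∈ {ω | T ω ≤ x} from h), hF,
          indicator_of_mem (show (x, ω) ∈ S from h)]
      · rw [indicator_of_notMem (show ω ∉ {ω | T ω ≤ x} from h), hF,
          indicator_of_notMem (show (x, ω) ∉ S from h)]
    rw [e1, integral_indicator hm, setIntegral_const, smul_eq_mul, real_smul, mul_comm]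
  constructor
  · have := hint.integral_prod_left
    simp only [hin] at this
    exact this
  · rw [mellin]
    simp_rw [← hin]
    rw [integral_integral_swap (f := fun x ω => F (x, ω)) hint, ← hM, ← integral_div]
    refine integral_congr_ae ?_
    filter_upwards [hT0] with ω hω
    rw [hsec, integral_indicator measurableSet_Ici, Measure.restrict_restrict measurableSet_Ici,
      hinter ω hω, integral_Ici_eq_integral_Ioi, integral_Ioi_cpow_of_lt he1 hω, sub_add_cancel,
      neg_div, div_neg]

/-- For `W` independent of `D`, the probability of `W ≤ q(D)` is the average over `D` of the
distribution function of `W`. -/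
lemma measureReal_le_comp {W D : Ω → ℝ} (hW : Measurable W) (hD : Measurable D)
    (hWD : W ⟂ᵢ[P] D) {q : ℝ → ℝ} (hq : Measurable q) :
    P.real {ω | W ω ≤ q (D ω)} = ∫ d, P.real {ω | W ω ≤ q d} ∂(P.map D) := by
  have := Measure.isProbabilityMeasure_map (μ := P) hW.aemeasurable
  have := Measure.isProbabilityMeasure_map (μ := P) hD.aemeasurable
  have hms : MeasurableSet {z : ℝ × ℝ | z.2 ≤ q z.1} :=
    measurableSet_le measurable_snd (hq.comp measurable_fst)
  have h1 : P {ω | W ω ≤ q (D ω)} = ∫⁻ d, P {ω | W ω ≤ q d} ∂(P.map D) := by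
    have e : {ω | W ω ≤ q (D ω)} = (fun ω => (D ω, W ω)) ⁻¹' {z : ℝ × ℝ | z.2 ≤ q z.1} := rfl
    rw [e, ← Measure.map_apply (hD.prodMk hW) hms,
      (indepFun_iff_map_prod_eq_prod_map_map hD.aemeasurable hW.aemeasurable).1 hWD.symm,
      Measure.prod_apply hms]
    refine lintegral_congr fun d => ?_
    rw [Measure.map_apply hW (measurable_prodMk_left hms)]
    rfl
  have hmono : Monotone fun y => P {ω | W ω ≤ y} := fun y z hyz =>
    measure_mono fun ω (hω : W ω ≤ y) => hω.trans hyz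
  have hmeas : Measurable fun d => P {ω | W ω ≤ q d} := hmono.measurable.comp hq
  rw [measureReal_def, h1]
  exact (integral_toReal hmeas.aemeasurable (Eventually.of_forall fun d => measure_lt_top _ _)).symm

/-- The function `Γ(μ) Γ(m) / β ^ 2 * x ^ (-μ) F((C x) ^ (2 / α))`, whose Mellin transform is the
kernel of the distribution function if `F` is the distribution function of the channel power and
`C = c₂`. -/
noncomputable def foxFun (α μ β m C : ℝ) (F : ℝ → ℝ) (x : ℝ) : ℂ :=
  ((Real.Gamma μ * Real.Gamma m / β ^ 2 * (x ^ (-μ) * F ((C * x) ^ (2 / α))) : ℝ) : ℂ)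

/-- The kernel of the distribution function is the Mellin transform of `foxFun`. Its two groups of
factors are the moments of the two powers: `Γ(s) Γ(μ + m - s)` comes from the fading and
`(β - α μ + α s) ^ (-2)` from the pointing error, while `1 / (μ - s)` turns moments into the
transform of a distribution function. -/
lemma hasMellin_foxFun {α μ β m lam Ωf : ℝ} (hα : 0 < α) (hμ : 0 < μ) (hβ : 0 < β) (hm : 1 < m)
    (hlam : 0 < lam) (hΩf : 0 < Ωf) {U V : Ω → ℝ} (hU : Measurable U) (hV : Measurable V)
    (hUV : U ⟂ᵢ[P] V)
    (hlawU : P.map U = volume.withDensity (fun z => ENNReal.ofReal (pointingPDF β z)))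
    (hlawV : P.map V = volume.withDensity (fun x => ENNReal.ofReal (alphaFPDF α μ m lam Ωf x)))
    (hnorm : (∫ ω, U ω ∂P) * Ωf = 1) {s : ℂ} (hs : InStrip α μ β s.re) :
    HasMellin (foxFun α μ β m (c₂ α μ β m lam) fun y => P.real {ω | U ω * V ω ≤ y}) s
      (foxKernel 3 2 (cdfUpper α μ β m) (foxLower α μ β) s) := by
  obtain ⟨h0, h1, h2⟩ := id hs
  have hK := c₂_eq_of_normalized (α := α) (μ := μ) (m := m) (lam := lam) hβ hU hlawU hnorm
  have hC := c₂_pos (α := α) hμ hβ hm hlam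
  set C := c₂ α μ β m lam with hCdef
  set e : ℂ := s - μ with he
  have here : e.re = s.re - μ := by simp [he]
  have mU := integrable_and_integral_cpow_of_law hU (measurable_pointingPDF β)
    (fun x _ => pointingPDF_nonneg β x) (fun x hx => pointingPDF_of_nonpos β hx) hlawU
    (hasMellin_pointingPDF (β := β) (r := α / 2 * e) (by
      have : ((α : ℂ) / 2 * e).re = α / 2 * (s.re - μ) := by
        rw [show (α : ℂ) / 2 = ((α / 2 : ℝ) : ℂ) by push_cast; ring, re_ofReal_mul, here]
      rw [this]; linarith))
  have mV := integrable_and_integral_cpow_of_law hV (measurable_alphaFPDF α μ m lam Ωf)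
    (fun x _ => alphaFPDF_nonneg hα hμ hm hlam hΩf) (fun x hx => alphaFPDF_of_nonpos _ _ _ _ _ hx)
    hlawV (hasMellin_alphaFPDF (q := e) hα hμ (by linarith) hK hC (by rw [here]; linarith)
      (by rw [here]; linarith))
  have pU := ae_gt_of_law hU (fun x hx => pointingPDF_of_nonpos β hx) hlawU
  have pV := ae_gt_of_law hV (fun x hx => alphaFPDF_of_nonpos α μ m lam Ωf hx) hlawV
  -- `U V ≤ (C x) ^ (2 / α)` means `T ≤ x`, so only the moments of `T` are needed
  set T : Ω → ℝ := fun ω => C⁻¹ * (U ω * V ω) ^ (α / 2) with hT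
  have hTm : Measurable T := by fun_prop
  have hT0 : ∀ᵐ ω ∂P, 0 < T ω := by
    filter_upwards [pU, pV] with ω hu hv
    positivity
  have hCc : (C : ℂ) ≠ 0 := by exact_mod_cast hC.ne'
  have hTe : ∀ᵐ ω ∂P, (C : ℂ) ^ (-e) * ((U ω : ℂ) ^ ((α : ℂ) / 2 * e) *
      (V ω : ℂ) ^ ((α : ℂ) / 2 * e)) = (T ω : ℂ) ^ e := by
    filter_upwards [pU, pV] with ω hu hv
    have hpow : ∀ x : ℝ, 0 < x → ((x ^ (α / 2) : ℝ) : ℂ) ^ e = (x : ℂ) ^ ((α : ℂ) / 2 * e) := by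
      intro x hx
      rw [cpow_ofReal_rpow hx]
      push_cast; rfl
    have hCinv : ((C⁻¹ : ℝ) : ℂ) ^ e = (C : ℂ) ^ (-e) := by
      rw [ofReal_inv, inv_cpow, cpow_neg]
      rw [arg_ofReal_of_nonneg hC.le]; exact Real.pi_pos.ne
    rw [hT]
    simp only
    rw [Real.mul_rpow hu.le hv.le, ofReal_mul, mul_cpow_ofReal_nonneg (inv_pos.2 hC).le
      (mul_nonneg (Real.rpow_nonneg hu.le _) (Real.rpow_nonneg hv.le _)), ofReal_mul,
      mul_cpow_ofReal_nonneg (Real.rpow_nonneg hu.le _) (Real.rpow_nonneg hv.le _),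
      hpow _ hu, hpow _ hv, hCinv]
  have hpm : Measurable fun x : ℝ => (x : ℂ) ^ ((α : ℂ) / 2 * e) := by fun_prop
  have hind : (fun ω => (U ω : ℂ) ^ ((α : ℂ) / 2 * e)) ⟂ᵢ[P]
      (fun ω => (V ω : ℂ) ^ ((α : ℂ) / 2 * e)) := hUV.comp hpm hpm
  have hTi : Integrable (fun ω => (T ω : ℂ) ^ e) P :=
    ((hind.integrable_mul mU.1 mV.1).const_mul ((C : ℂ) ^ (-e))).congr hTe
  have hTv := (integral_congr_ae hTe).symm
  rw [integral_const_mul, hind.integral_fun_mul_eq_mul_integral mU.1.aestronglyMeasurable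
    mV.1.aestronglyMeasurable, mU.2, mV.2] at hTv
  have hmel := hasMellin_measureReal_le hTm hT0 (by rw [here]; linarith) hTi hTv
  have hes : e = s + ((-μ : ℝ) : ℂ) := by rw [he]; push_cast; ring
  obtain ⟨hconv, hmel⟩ := hmel
  have hconv' := MellinConvergent.cpow_smul.2 (hes ▸ hconv)
  have hmel' := (mellin_cpow_smul (fun x => (P.real {ω | T ω ≤ x} : ℂ)) s ((-μ : ℝ) : ℂ)).trans
    ((congrArg _ hes.symm).trans hmel)
  have hfin := hasMellin_const_smul hconv' ((Real.Gamma μ * Real.Gamma m / β ^ 2 : ℝ) : ℂ)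
  rw [hmel'] at hfin
  have hset : ∀ x : ℝ, 0 < x →
      P.real {ω | T ω ≤ x} = P.real {ω | U ω * V ω ≤ (C * x) ^ (2 / α)} := by
    intro x hx
    refine measureReal_congr ?_
    filter_upwards [pU, pV] with ω hu hv
    have huv : 0 < U ω * V ω := mul_pos hu hv
    refine propext ?_
    change T ω ≤ x ↔ U ω * V ω ≤ (C * x) ^ (2 / α)
    rw [hT]
    simp only
    rw [inv_mul_le_iff₀ hC, show 2 / α = (α / 2)⁻¹ by rw [inv_div],
      Real.le_rpow_inv_iff_of_pos huv.le (by positivity) (by positivity)]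
  have hcongr : ∀ x ∈ Ioi (0 : ℝ),
      ((Real.Gamma μ * Real.Gamma m / β ^ 2 : ℝ) : ℂ) • (x : ℂ) ^ ((-μ : ℝ) : ℂ) •
        (P.real {ω | T ω ≤ x} : ℂ) =
      foxFun α μ β m C (fun y => P.real {ω | U ω * V ω ≤ y}) x := by
    intro x hx
    have hx0 : 0 < x := hx
    rw [hset x hx0, foxFun, ← ofReal_cpow hx0.le]
    simp only [smul_eq_mul]
    push_cast
    ring
  have hcongr' : ∀ x ∈ Ioi (0 : ℝ), (x : ℂ) ^ (s - 1) •
      (((Real.Gamma μ * Real.Gamma m / β ^ 2 : ℝ) : ℂ) • (x : ℂ) ^ ((-μ : ℝ) : ℂ) •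
        (P.real {ω | T ω ≤ x} : ℂ)) = (x : ℂ) ^ (s - 1) •
      foxFun α μ β m C (fun y => P.real {ω | U ω * V ω ≤ y}) x := fun x hx => by
    rw [hcongr x hx]
  refine ⟨hfin.1.congr_fun hcongr' measurableSet_Ioi, ?_⟩
  rw [mellin, ← setIntegral_congr_fun measurableSet_Ioi hcongr']
  have hval := hfin.2
  rw [mellin] at hval
  rw [hval, foxKernel_cdf hs]
  have hG1 : Gamma (μ : ℂ) ≠ 0 := Gamma_ne_zero_of_re_pos (by simpa using hμ)
  have hG2 : Gamma (m : ℂ) ≠ 0 := Gamma_ne_zero_of_re_pos (by simp; linarith)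
  have hβc : (β : ℂ) ≠ 0 := by exact_mod_cast hβ.ne'
  have hCe : (C : ℂ) ^ (-e) * (C : ℂ) ^ e = 1 := by
    rw [← cpow_add _ _ hCc, neg_add_cancel, cpow_zero]
  have hp : ((β : ℂ) - α * μ + α * s) ≠ 0 := fun h => by
    have := congrArg re h
    simp [mul_re] at this
    linarith
  have hq : (μ : ℂ) - s ≠ 0 := fun h => by
    have := congrArg re h
    simp at this
    linarith
  have hden : (β : ℂ) / 2 + α / 2 * e = (β - α * μ + α * s) / 2 := by rw [he]; ring
  have hne : -e = μ - s := by rw [he]; ring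
  rw [hden, show (μ : ℂ) + e = s by rw [he]; ring, show (m : ℂ) - e = μ + m - s by rw [he]; ring]
  simp only [smul_eq_mul]
  push_cast
  rw [← Gamma_ofReal, ← Gamma_ofReal]
  rw [show (C : ℂ) ^ (-e) * ((β : ℂ) ^ 2 / 4 / ((β - α * μ + α * s) / 2) ^ 2 *
      ((C : ℂ) ^ e * (Gamma s * Gamma (μ + m - s)) / (Gamma μ * Gamma m))) =
      ((C : ℂ) ^ (-e) * (C : ℂ) ^ e) * ((β : ℂ) ^ 2 / 4 / ((β - α * μ + α * s) / 2) ^ 2 *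
      ((Gamma s * Gamma (μ + m - s)) / (Gamma μ * Gamma m))) by ring, hCe, hne]
  field_simp
  norm_num

end Probability

end THz

/-! ### The H-functions of the distribution function and of the error probability -/

namespace THz

open Complex Set

lemma continuousAt_foxFun {α μ β m C : ℝ} {F : ℝ → ℝ} (hα : 0 < α) (hF : Continuous F) {x : ℝ}
    (hx : 0 < x) : ContinuousAt (foxFun α μ β m C F) x := by
  have h1 : ContinuousAt (fun x : ℝ => x ^ (-μ)) x :=
    Real.continuousAt_rpow_const _ _ (Or.inl hx.ne')
  have h2 : Continuous (fun x : ℝ => (C * x) ^ (2 / α)) :=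
    (continuous_const.mul continuous_id).rpow_const fun _ => Or.inr (by positivity)
  exact continuous_ofReal.continuousAt.comp
    (continuousAt_const.mul (h1.mul (hF.comp h2).continuousAt))

/-- `G` is the function behind the H-function of the distribution function: it is continuous on
the positive half-line and the kernel is its Mellin transform on the whole strip. The parameters
are those of a nonempty strip. -/
structure IsInverseTransform (α μ β m : ℝ) (G : ℝ → ℂ) : Prop where
  α_pos : 0 < α
  μ_pos : 0 < μ
  β_pos : 0 < β
  m_pos : 0 < m
  continuousAt : ∀ x, 0 < x → ContinuousAt G x
  hasMellin : ∀ s : ℂ, InStrip α μ β s.re →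
    HasMellin G s (foxKernel 3 2 (cdfUpper α μ β m) (foxLower α μ β) s)

namespace IsInverseTransform

variable {α μ β m : ℝ} {G : ℝ → ℂ}

lemma mellinInv_cdf (h : IsInverseTransform α μ β m G) {c x : ℝ} (hc : InStrip α μ β c)
    (hx : 0 < x) :
    mellinInv c (foxKernel 3 2 (cdfUpper α μ β m) (foxLower α μ β)) x = G x :=
  mellinInv_eq_of_mellin hx (verticalIntegrable_cdf h.α_pos h.m_pos hc)
    (fun y => h.hasMellin _ (by rwa [re_line])) (h.continuousAt x hx)

lemma foxH_cdf (h : IsInverseTransform α μ β m G) {x : ℝ} (hx : 0 < x) :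
    foxH 3 2 (cdfUpper α μ β m) (foxLower α μ β) x = G x := by
  obtain ⟨c, hc⟩ := exists_inStrip h.α_pos h.μ_pos h.β_pos
  exact foxH_eq_of_forall ⟨c, (foxSeparates_cdf_iff h.α_pos h.m_pos c).2 hc⟩ fun c' hc' =>
    h.mellinInv_cdf ((foxSeparates_cdf_iff h.α_pos h.m_pos c').1 hc') hx

lemma foxWellDefined_cdf (h : IsInverseTransform α μ β m G) {z : ℝ} (hz : 0 < z) :
    FoxWellDefined 3 2 (cdfUpper α μ β m) (foxLower α μ β) z := by
  obtain ⟨c, hc⟩ := exists_inStrip h.α_pos h.μ_pos h.β_pos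
  refine ⟨⟨c, (foxSeparates_cdf_iff h.α_pos h.m_pos c).2 hc⟩, fun c' hc' => ?_⟩
  rw [foxSeparates_cdf_iff h.α_pos h.m_pos] at hc'
  exact ⟨verticalIntegrable_cpow_mul (verticalIntegrable_cdf h.α_pos h.m_pos hc') hz, by
    rw [h.mellinInv_cdf hc' hz, h.foxH_cdf hz]⟩

/-- On every separating line the Mellin-Barnes integral of the error probability is a Laplace-type
integral of the H-function of the distribution function, which no longer refers to the line. -/
lemma integral_foxH_cdf_eq_mellinInv (h : IsInverseTransform α μ β m G) {c r w : ℝ}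
    (hc : InStrip α μ β c) (hr : 0 < r) (hw : 0 < w) :
    IntegrableOn (fun γ : ℝ => ((γ ^ (1 / 2 + α * μ / 2 - 1) * Real.exp (-r * γ) : ℝ) : ℂ) *
        foxH 3 2 (cdfUpper α μ β m) (foxLower α μ β) (w * γ ^ (α / 2))) (Ioi 0) ∧
      ∫ γ in Ioi (0 : ℝ), ((γ ^ (1 / 2 + α * μ / 2 - 1) * Real.exp (-r * γ) : ℝ) : ℂ) *
        foxH 3 2 (cdfUpper α μ β m) (foxLower α μ β) (w * γ ^ (α / 2)) =
      ((r ^ (-(1 / 2 + α * μ / 2)) : ℝ) : ℂ) *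
        mellinInv c (foxKernel 3 3 (asepUpper α μ β m) (foxLower α μ β))
          (w * r ^ (-(α / 2))) := by
  have hpc : 0 < 1 / 2 + α * μ / 2 - α / 2 * c := by
    have := mul_lt_mul_of_pos_left hc.2.2 h.α_pos
    linarith
  have hI := integral_rpow_exp_mellinInv (verticalIntegrable_cdf h.α_pos h.m_pos hc) hr hw hpc
  have hcongr : ∀ γ ∈ Ioi (0 : ℝ),
      ((γ ^ (1 / 2 + α * μ / 2 - 1) * Real.exp (-r * γ) : ℝ) : ℂ) *
        mellinInv c (foxKernel 3 2 (cdfUpper α μ β m) (foxLower α μ β)) (w * γ ^ (α / 2)) =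
      ((γ ^ (1 / 2 + α * μ / 2 - 1) * Real.exp (-r * γ) : ℝ) : ℂ) *
        foxH 3 2 (cdfUpper α μ β m) (foxLower α μ β) (w * γ ^ (α / 2)) := fun γ hγ => by
    have hz : 0 < w * γ ^ (α / 2) := mul_pos hw (Real.rpow_pos_of_pos hγ _)
    rw [h.mellinInv_cdf hc hz, h.foxH_cdf hz]
  refine ⟨hI.1.congr_fun hcongr measurableSet_Ioi, ?_⟩
  rw [← setIntegral_congr_fun measurableSet_Ioi hcongr, hI.2]
  congr 2
  ext s
  rw [foxKernel_asep]
  push_cast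
  rfl

lemma mellinInv_asep_eq (h : IsInverseTransform α μ β m G) {c c' z : ℝ}
    (hc : InStrip α μ β c) (hc' : InStrip α μ β c') (hz : 0 < z) :
    mellinInv c (foxKernel 3 3 (asepUpper α μ β m) (foxLower α μ β)) z =
      mellinInv c' (foxKernel 3 3 (asepUpper α μ β m) (foxLower α μ β)) z := by
  have h1 := (h.integral_foxH_cdf_eq_mellinInv hc one_pos hz).2
  have h2 := (h.integral_foxH_cdf_eq_mellinInv hc' one_pos hz).2
  rw [h1] at h2
  simpa using h2

lemma foxH_asep (h : IsInverseTransform α μ β m G) {c z : ℝ} (hc : InStrip α μ β c)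
    (hz : 0 < z) :
    foxH 3 3 (asepUpper α μ β m) (foxLower α μ β) z =
      mellinInv c (foxKernel 3 3 (asepUpper α μ β m) (foxLower α μ β)) z :=
  foxH_eq_of_forall ⟨c, (foxSeparates_asep_iff h.α_pos h.m_pos c).2 hc⟩ fun _ hc' =>
    h.mellinInv_asep_eq ((foxSeparates_asep_iff h.α_pos h.m_pos _).1 hc') hc hz

lemma foxWellDefined_asep (h : IsInverseTransform α μ β m G) {z : ℝ} (hz : 0 < z) :
    FoxWellDefined 3 3 (asepUpper α μ β m) (foxLower α μ β) z := by
  obtain ⟨c, hc⟩ := exists_inStrip h.α_pos h.μ_pos h.β_pos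
  refine ⟨⟨c, (foxSeparates_asep_iff h.α_pos h.m_pos c).2 hc⟩, fun c' hc' => ?_⟩
  rw [foxSeparates_asep_iff h.α_pos h.m_pos] at hc'
  exact ⟨verticalIntegrable_cpow_mul (verticalIntegrable_asep h.α_pos h.m_pos hc') hz,
    (h.foxH_asep hc' hz).symm⟩

lemma integral_foxH_cdf (h : IsInverseTransform α μ β m G) {r w : ℝ} (hr : 0 < r) (hw : 0 < w) :
    IntegrableOn (fun γ : ℝ => ((γ ^ (1 / 2 + α * μ / 2 - 1) * Real.exp (-r * γ) : ℝ) : ℂ) *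
        foxH 3 2 (cdfUpper α μ β m) (foxLower α μ β) (w * γ ^ (α / 2))) (Ioi 0) ∧
      ∫ γ in Ioi (0 : ℝ), ((γ ^ (1 / 2 + α * μ / 2 - 1) * Real.exp (-r * γ) : ℝ) : ℂ) *
        foxH 3 2 (cdfUpper α μ β m) (foxLower α μ β) (w * γ ^ (α / 2)) =
      ((r ^ (-(1 / 2 + α * μ / 2)) : ℝ) : ℂ) *
        foxH 3 3 (asepUpper α μ β m) (foxLower α μ β) (w * r ^ (-(α / 2))) := by
  obtain ⟨c, hc⟩ := exists_inStrip h.α_pos h.μ_pos h.β_pos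
  rw [h.foxH_asep hc (mul_pos hw (Real.rpow_pos_of_pos hr _))]
  exact h.integral_foxH_cdf_eq_mellinInv hc hr hw

end IsInverseTransform

end THz

/-! ### The average over the distance -/

namespace THz

open Set

/-- The integrand, over `x ∈ [-1, 1]`, of the distribution function of the SNR at `γ = g γ₀`: with
`y = (RM / (2 d₀)) (x + 1)`, which is `d - 1` for a distance `d`, the random waypoint density at
`d` times the distribution function `F` of the channel power at the value that makes the SNR equal
to `γ`. -/
noncomputable def distIntegrand (δ κ d₀ RM : ℝ) {l : ℕ} (B ν : Fin l → ℝ) (F : ℝ → ℝ) (g x : ℝ) :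
    ℝ :=
  RM / (2 * d₀) * (∑ i, B i * (d₀ / RM) ^ (ν i + 1) * (RM / (2 * d₀) * (x + 1)) ^ ν i) *
    F ((RM / (2 * d₀) * (x + 1)) ^ δ *
      Real.exp (κ * d₀ * (RM / (2 * d₀) * (x + 1) + 1)) * g)

section Quadrature

variable {α μ β m lam δ γ₀ κ d₀ RM : ℝ} {l : ℕ} {B ν : Fin l → ℝ} {F : ℝ → ℝ}

lemma Phi_v₂_pos (hd₀ : 0 < d₀) (hRM : 0 < RM) {x : ℝ} (hx : -1 < x) :
    0 < Phi x (v₂ α δ κ d₀ RM) := by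
  have : 0 < x + 1 := by linarith
  simp only [Phi, v₂, Matrix.cons_val]
  positivity

/-- The quadrature form of the distribution function is the Gauss-Legendre sum of
`distIntegrand`. -/
lemma quadCDF_eq (hα : 0 < α) (hμ : 0 < μ) (hβ : 0 < β) (hm : 1 < m) (hlam : 0 < lam)
    (hd₀ : 0 < d₀) (hRM : 0 < RM) (hγ₀ : 0 < γ₀)
    (h : IsInverseTransform α μ β m (foxFun α μ β m (c₂ α μ β m lam) F)) (N : ℕ) {γ : ℝ}
    (hγ : 0 < γ) :
    quadCDF α μ β m lam δ γ₀ κ d₀ RM B ν N γ =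
      ((∑ x ∈ glNodes N, glWeight N x * distIntegrand δ κ d₀ RM B ν F (γ / γ₀) x : ℝ) : ℂ) := by
  have hC := c₂_pos (α := α) hμ hβ hm hlam
  have hc₁ : c₁ α μ β m lam =
      β ^ 2 * α / (8 * ProbabilityTheory.beta μ m) * c₂ α μ β m lam ^ m := by
    rw [c₁, c₂, mul_right_comm (β ^ α), mul_comm (β ^ α * μ),
      show lam ^ (α / 2) * (β ^ α * μ) = lam ^ (α / 2) * μ * β ^ α by ring]
  set C := c₂ α μ β m lam with hCdef
  set g := γ / γ₀ with hg
  have hg0 : 0 < g := by positivity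
  rw [quadCDF, ← hCdef, ← hg, Finset.sum_comm, Finset.mul_sum, Complex.ofReal_sum]
  refine Finset.sum_congr rfl fun x hx => ?_
  have hx1 : 0 < x + 1 := by linarith [(mem_Ioo_of_mem_glNodes hx).1]
  set y := RM / (2 * d₀) * (x + 1) with hy
  have hy0 : 0 < y := by positivity
  set E := Real.exp (κ * d₀ * (y + 1)) with hE
  have hE0 : 0 < E := Real.exp_pos _
  set Q := y ^ δ * E with hQ
  have hyδ : 0 < y ^ δ := Real.rpow_pos_of_pos hy0 _
  have hQ0 : 0 < Q := by positivity
  have hΦ2 : Phi x (v₂ α δ κ d₀ RM) = Q ^ (α / 2) := by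
    simp only [Phi, v₂, Matrix.cons_val]
    rw [← hy, hQ, Real.mul_rpow hyδ.le hE0.le, ← Real.rpow_mul hy0.le, hE, ← Real.exp_mul]
    congr 2 <;> ring
  have hΦ1 : ∀ i, Phi x (v₁ α μ δ κ d₀ RM (ν i)) = y ^ ν i * Q ^ (α * μ / 2) := by
    intro i
    simp only [Phi, v₁, Matrix.cons_val]
    rw [← hy, hQ, Real.mul_rpow hyδ.le hE0.le, ← Real.rpow_mul hy0.le, hE, ← Real.exp_mul,
      Real.rpow_add hy0, mul_assoc]
    congr 3 <;> ring
  have hz : 0 < Q ^ (α / 2) / C * g ^ (α / 2) := by positivity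
  have hfox : foxFun α μ β m C F (Q ^ (α / 2) / C * g ^ (α / 2)) =
      ((Real.Gamma μ * Real.Gamma m / β ^ 2 *
        (Q ^ (-(α * μ / 2)) * C ^ μ * g ^ (-(α * μ / 2)) * F (Q * g)) : ℝ) : ℂ) := by
    have e1 : (C * (Q ^ (α / 2) / C * g ^ (α / 2))) ^ (2 / α) = Q * g := by
      rw [show C * (Q ^ (α / 2) / C * g ^ (α / 2)) = Q ^ (α / 2) * g ^ (α / 2) by field_simp,
        ← Real.mul_rpow hQ0.le hg0.le, ← Real.rpow_mul (by positivity),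
        show α / 2 * (2 / α) = 1 by field_simp, Real.rpow_one]
    have e2 : (Q ^ (α / 2) / C * g ^ (α / 2)) ^ (-μ) =
        Q ^ (-(α * μ / 2)) * C ^ μ * g ^ (-(α * μ / 2)) := by
      rw [Real.mul_rpow (by positivity) (by positivity), Real.div_rpow (by positivity) hC.le,
        ← Real.rpow_mul hQ0.le, ← Real.rpow_mul hg0.le, Real.rpow_neg hC.le, div_inv_eq_mul]
      congr 3 <;> ring
    rw [foxFun, e1, e2]
  simp only [hΦ2, hΦ1, h.foxH_cdf hz, hfox]
  norm_cast
  rw [distIntegrand, ← hy, ← hE, ← hQ, hc₁, ProbabilityTheory.beta]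
  have p1 : Q ^ (-(α * μ / 2)) = (Q ^ (α * μ / 2))⁻¹ := Real.rpow_neg hQ0.le _
  have p2 : g ^ (-(α * μ / 2)) = (g ^ (α * μ / 2))⁻¹ := Real.rpow_neg hg0.le _
  have p3 : C ^ (-(μ + m)) = (C ^ μ * C ^ m)⁻¹ := by
    rw [Real.rpow_neg hC.le, Real.rpow_add hC]
  have hGμ := Real.Gamma_pos_of_pos hμ
  have hGm := Real.Gamma_pos_of_pos (show 0 < m by linarith)
  have hGμm := Real.Gamma_pos_of_pos (show 0 < μ + m by linarith)
  have hQp : 0 < Q ^ (α * μ / 2) := Real.rpow_pos_of_pos hQ0 _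
  have hgp : 0 < g ^ (α * μ / 2) := Real.rpow_pos_of_pos hg0 _
  have hCμ : 0 < C ^ μ := Real.rpow_pos_of_pos hC _
  have hCm : 0 < C ^ m := Real.rpow_pos_of_pos hC _
  rw [Finset.mul_sum, Finset.mul_sum, Finset.sum_mul, Finset.mul_sum]
  refine Finset.sum_congr rfl fun i _ => ?_
  rw [p1, p2, p3]
  field_simp
  ring

/-- Integration of the quadrature form term by term. -/
lemma integral_quadCDF (hμ : 0 < μ) (hβ : 0 < β) (hm : 1 < m) (hlam : 0 < lam)
    (hd₀ : 0 < d₀) (hRM : 0 < RM) (hγ₀ : 0 < γ₀) {G : ℝ → ℂ}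
    (h : IsInverseTransform α μ β m G) {a b : ℝ} (hb : 0 < b) (N : ℕ) :
    IntegrableOn (fun γ : ℝ => ((γ ^ (-(1 / 2) : ℝ) : ℝ) : ℂ) *
        quadCDF α μ β m lam δ γ₀ κ d₀ RM B ν N γ * ((Real.exp (-(b / 2) * γ) : ℝ) : ℂ))
        (Set.Ioi 0) ∧
      asep a b (quadCDF α μ β m lam δ γ₀ κ d₀ RM B ν N) =
        asepClosed α μ β m lam δ γ₀ κ d₀ RM a b B ν N := by
  have hC := c₂_pos (α := α) hμ hβ hm hlam
  have hα := h.α_pos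
  set C := c₂ α μ β m lam with hCdef
  set p : ℝ := 1 / 2 + α * μ / 2 with hp
  set A : ℝ := 4 * RM * c₁ α μ β m lam * C ^ (-(μ + m)) / (α * d₀ * Real.Gamma (μ + m)) with hA
  set w : ℝ → ℝ := fun x => Phi x (v₂ α δ κ d₀ RM) / C * γ₀ ^ (-(α / 2)) with hw
  have hw0 : ∀ x ∈ glNodes N, 0 < w x := fun x hx => by
    have := Phi_v₂_pos (α := α) (δ := δ) (κ := κ) hd₀ hRM (mem_Ioo_of_mem_glNodes hx).1
    positivity
  set co : Fin l → ℝ → ℂ := fun i x =>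
    ((B i * (d₀ / RM) ^ (ν i + 1) * glWeight N x * Phi x (v₁ α μ δ κ d₀ RM (ν i)) : ℝ) : ℂ)
    with hco
  have hterm := fun x hx => h.integral_foxH_cdf (r := b / 2) (by positivity) (hw0 x hx)
  have hcongr : ∀ γ ∈ Ioi (0 : ℝ), ((γ ^ (-(1 / 2) : ℝ) : ℝ) : ℂ) *
        quadCDF α μ β m lam δ γ₀ κ d₀ RM B ν N γ * ((Real.exp (-(b / 2) * γ) : ℝ) : ℂ) =
      ((A * γ₀ ^ (-(α * μ / 2)) : ℝ) : ℂ) * ∑ i, ∑ x ∈ glNodes N, co i x *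
        (((γ ^ (p - 1) * Real.exp (-(b / 2) * γ) : ℝ) : ℂ) *
        foxH 3 2 (cdfUpper α μ β m) (foxLower α μ β) (w x * γ ^ (α / 2))) := by
    intro γ hγ
    have hγ0 : 0 < γ := hγ
    have hpow : γ ^ (p - 1) = γ ^ (-(1 / 2) : ℝ) * γ ^ (α * μ / 2) := by
      rw [← Real.rpow_add hγ0]; congr 1; rw [hp]; ring
    have harg : ∀ x, Phi x (v₂ α δ κ d₀ RM) / C * (γ / γ₀) ^ (α / 2) = w x * γ ^ (α / 2) := by
      intro x
      rw [Real.div_rpow hγ0.le hγ₀.le, hw]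
      simp only
      rw [Real.rpow_neg hγ₀.le]
      ring
    rw [quadCDF, ← hCdef, ← hA, Real.div_rpow hγ0.le hγ₀.le, hpow, Real.rpow_neg hγ₀.le]
    simp only [harg]
    rw [Finset.mul_sum, Finset.mul_sum, Finset.mul_sum, Finset.sum_mul]
    refine Finset.sum_congr rfl fun i _ => ?_
    rw [Finset.mul_sum, Finset.mul_sum, Finset.mul_sum, Finset.sum_mul]
    refine Finset.sum_congr rfl fun x _ => ?_
    simp only [hco]
    push_cast
    ring
  have hint : ∀ i, ∀ x ∈ glNodes N, IntegrableOn (fun γ : ℝ => co i x *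
        (((γ ^ (p - 1) * Real.exp (-(b / 2) * γ) : ℝ) : ℂ) *
        foxH 3 2 (cdfUpper α μ β m) (foxLower α μ β) (w x * γ ^ (α / 2)))) (Ioi 0) :=
    fun i x hx => (hterm x hx).1.const_mul _
  have hint2 : ∀ i, IntegrableOn (fun γ : ℝ => ∑ x ∈ glNodes N, co i x *
        (((γ ^ (p - 1) * Real.exp (-(b / 2) * γ) : ℝ) : ℂ) *
        foxH 3 2 (cdfUpper α μ β m) (foxLower α μ β) (w x * γ ^ (α / 2)))) (Ioi 0) :=
    fun i => integrable_finsetSum _ fun x hx => hint i x hx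
  constructor
  · rw [integrableOn_congr_fun hcongr measurableSet_Ioi]
    exact (integrable_finsetSum _ fun i _ => hint2 i).const_mul _
  · have hb2 : 0 < b / 2 := by positivity
    have harg : ∀ x, w x * (b / 2) ^ (-(α / 2)) =
        Phi x (v₂ α δ κ d₀ RM) / (C * (b / 2 * γ₀) ^ (α / 2)) := by
      intro x
      simp only [hw]
      rw [Real.mul_rpow hb2.le hγ₀.le, Real.rpow_neg hb2.le, Real.rpow_neg hγ₀.le]
      field_simp
    -- `√b` cancels against the half power of `b / 2` that the Laplace-type integral produces
    have hconst : a * √b / (2 * √(2 * Real.pi)) * (A * γ₀ ^ (-(α * μ / 2))) * (b / 2) ^ (-p) =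
        2 * a * RM * c₁ α μ β m lam * C ^ (-(μ + m)) /
          (√Real.pi * α * d₀ * Real.Gamma (μ + m)) * (γ₀ * b / 2) ^ (-(α * μ / 2)) := by
      have hbp : (b / 2) ^ (-p) = (√b)⁻¹ * √2 * (b / 2) ^ (-(α * μ / 2)) := by
        rw [hp, neg_add, Real.rpow_add hb2]
        congr 1
        rw [Real.rpow_neg hb2.le, ← Real.sqrt_eq_rpow, Real.sqrt_div hb.le, inv_div,
          div_eq_inv_mul]
      rw [hbp, show γ₀ * b / 2 = γ₀ * (b / 2) by ring, Real.mul_rpow hγ₀.le hb2.le,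
        Real.sqrt_mul (by norm_num), hA]
      have : 0 < √b := Real.sqrt_pos.2 hb
      have : 0 < √(2 : ℝ) := Real.sqrt_pos.2 (by norm_num)
      have : 0 < √Real.pi := Real.sqrt_pos.2 Real.pi_pos
      have := Real.Gamma_pos_of_pos (show 0 < μ + m by linarith)
      field_simp
      ring
    rw [asep, setIntegral_congr_fun measurableSet_Ioi hcongr, integral_const_mul,
      integral_finsetSum _ fun i _ => hint2 i, asepClosed, ← hCdef, ← hconst]
    rw [Finset.mul_sum, Finset.mul_sum, Finset.mul_sum]
    refine Finset.sum_congr rfl fun i _ => ?_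
    rw [integral_finsetSum _ fun x hx => hint i x hx, Finset.mul_sum, Finset.mul_sum,
      Finset.mul_sum]
    refine Finset.sum_congr rfl fun x hx => ?_
    rw [integral_const_mul, (hterm x hx).2, harg]
    simp only [hco]
    push_cast
    ring

end Quadrature

section Model

variable {δ γ₀ κ d₀ RM : ℝ} {l : ℕ} {B ν : Fin l → ℝ}

lemma continuous_density_factor (d₀ RM : ℝ) (B : Fin l → ℝ) (hν : ∀ i, 0 ≤ ν i) :
    Continuous fun x : ℝ => RM / (2 * d₀) *
      ∑ i, B i * (d₀ / RM) ^ (ν i + 1) * (RM / (2 * d₀) * (x + 1)) ^ ν i :=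
  continuous_const.mul <| continuous_finsetSum _ fun i _ => continuous_const.mul <|
    Continuous.rpow_const (by fun_prop) fun _ => Or.inr (hν i)

lemma continuous_distIntegrand {F : ℝ → ℝ} (hF : Continuous F) (hν : ∀ i, 0 ≤ ν i) (hδ : 0 ≤ δ)
    (g : ℝ) : Continuous (distIntegrand δ κ d₀ RM B ν F g) := by
  have h1 : Continuous fun x : ℝ => (RM / (2 * d₀) * (x + 1)) ^ δ :=
    Continuous.rpow_const (by fun_prop) fun _ => Or.inr hδ
  exact (continuous_density_factor d₀ RM B hν).mul (hF.comp (by fun_prop))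

/-- The bound that dominates all the quadrature sums and their limit. -/
lemma exists_abs_distIntegrand_le (δ κ : ℝ) {F : ℝ → ℝ} (hF : ∀ y, |F y| ≤ 1)
    (hν : ∀ i, 0 ≤ ν i) :
    ∃ c, ∀ g, ∀ x ∈ Icc (-1 : ℝ) 1, |distIntegrand δ κ d₀ RM B ν F g x| ≤ c := by
  obtain ⟨c, hc⟩ := isCompact_Icc.exists_bound_of_continuousOn
    (continuous_density_factor d₀ RM B hν).continuousOn (s := Icc (-1 : ℝ) 1)
  refine ⟨c, fun g x hx => ?_⟩
  rw [distIntegrand, abs_mul]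
  exact (mul_le_of_le_one_right (abs_nonneg _) (hF _)).trans (hc x hx)

lemma measurable_rwpPDF : Measurable (rwpPDF d₀ RM B ν) := by
  unfold rwpPDF
  exact Measurable.ite measurableSet_Ioo (by fun_prop) measurable_const

variable {Ω : Type*} [MeasurableSpace Ω] {P : Measure Ω} [IsProbabilityMeasure P]

/-- The distribution function of the SNR is the integral of `distIntegrand`: condition on the
distance, and map its range `[1, 1 + RM / d₀]` onto `[-1, 1]`. -/
lemma measureReal_snr_le (hd₀ : 0 < d₀) (hRM : 0 < RM) (hγ₀ : 0 < γ₀) {Hp Hf D : Ω → ℝ}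
    (hHp : Measurable Hp) (hHf : Measurable Hf) (hD : Measurable D)
    (hindep : (fun ω => Hp ω ^ 2 * Hf ω ^ 2) ⟂ᵢ[P] D) (hrwp : ∀ d, 0 ≤ rwpPDF d₀ RM B ν d)
    (hlawD : P.map D = volume.withDensity (fun d => ENNReal.ofReal (rwpPDF d₀ RM B ν d)))
    (γ : ℝ) :
    P.real {ω | snr γ₀ δ κ d₀ (D ω) (Hp ω) (Hf ω) ≤ γ} =
      ∫ x in (-1 : ℝ)..1, distIntegrand δ κ d₀ RM B ν
        (fun y => P.real {ω | Hp ω ^ 2 * Hf ω ^ 2 ≤ y}) (γ / γ₀) x := by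
  set F : ℝ → ℝ := fun y => P.real {ω | Hp ω ^ 2 * Hf ω ^ 2 ≤ y} with hF
  set q : ℝ → ℝ := fun d => (d - 1) ^ δ * Real.exp (κ * d₀ * d) * (γ / γ₀) with hq
  have hqm : Measurable q := by fun_prop
  have hD1 : ∀ᵐ ω ∂P, 1 < D ω := ae_gt_of_law hD
    (fun x hx => if_neg fun h => not_le.2 h.1 hx) hlawD
  have h1 : P.real {ω | snr γ₀ δ κ d₀ (D ω) (Hp ω) (Hf ω) ≤ γ} =
      P.real {ω | Hp ω ^ 2 * Hf ω ^ 2 ≤ q (D ω)} := by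
    refine measureReal_congr ?_
    filter_upwards [hD1] with ω hω
    refine propext ?_
    change snr γ₀ δ κ d₀ (D ω) (Hp ω) (Hf ω) ≤ γ ↔ Hp ω ^ 2 * Hf ω ^ 2 ≤ q (D ω)
    have hd : 0 < D ω - 1 := by linarith
    have hdδ : 0 < (D ω - 1) ^ δ := Real.rpow_pos_of_pos hd _
    have he : 0 < Real.exp (κ * d₀ * D ω) := Real.exp_pos _
    rw [snr, Real.rpow_neg hd.le, Real.exp_neg]
    simp only [hq]
    rw [show γ₀ * ((D ω - 1) ^ δ)⁻¹ * (Real.exp (κ * d₀ * D ω))⁻¹ * Hp ω ^ 2 * Hf ω ^ 2 =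
        Hp ω ^ 2 * Hf ω ^ 2 * γ₀ / ((D ω - 1) ^ δ * Real.exp (κ * d₀ * D ω)) by
      field_simp, div_le_iff₀ (by positivity),
      show (D ω - 1) ^ δ * Real.exp (κ * d₀ * D ω) * (γ / γ₀) =
        γ * ((D ω - 1) ^ δ * Real.exp (κ * d₀ * D ω)) / γ₀ by ring, le_div_iff₀ hγ₀]
  have hW : Measurable fun ω => Hp ω ^ 2 * Hf ω ^ 2 := by fun_prop
  rw [h1, measureReal_le_comp hW hD hindep hqm, hlawD,
    integral_withDensity_eq_integral_toReal_smul measurable_rwpPDF.ennreal_ofReal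
      (Eventually.of_forall fun x => ENNReal.ofReal_lt_top)]
  set K := RM / (2 * d₀) with hK
  have hK0 : 0 < K := by positivity
  set f : ℝ → ℝ := fun d =>
    (∑ i, B i * (d₀ / RM) ^ (ν i + 1) * (d - 1) ^ ν i) * F (q d) with hf
  have hind : (fun d => (ENNReal.ofReal (rwpPDF d₀ RM B ν d)).toReal •
      P.real {ω | Hp ω ^ 2 * Hf ω ^ 2 ≤ q d}) = (Ioo 1 (1 + RM / d₀)).indicator f := by
    ext d
    rw [ENNReal.toReal_ofReal (hrwp d), smul_eq_mul]
    by_cases hd : d ∈ Ioo 1 (1 + RM / d₀)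
    · rw [indicator_of_mem hd, rwpPDF, if_pos (show 1 < d ∧ d < 1 + RM / d₀ from hd)]
    · rw [indicator_of_notMem hd, rwpPDF, if_neg (show ¬(1 < d ∧ d < 1 + RM / d₀) from hd), zero_mul]
  have hle : (1 : ℝ) ≤ 1 + RM / d₀ := by
    have : 0 < RM / d₀ := by positivity
    linarith
  rw [hind, integral_indicator measurableSet_Ioo, ← integral_Ioc_eq_integral_Ioo,
    ← intervalIntegral.integral_of_le hle]
  have hsub := intervalIntegral.integral_comp_mul_add (a := -1) (b := 1) f hK0.ne' (K + 1)
  rw [show K * -1 + (K + 1) = 1 by ring, show K * 1 + (K + 1) = 1 + RM / d₀ by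
    rw [hK]; field_simp; ring, smul_eq_mul, eq_inv_mul_iff_mul_eq₀ hK0.ne',
    ← intervalIntegral.integral_const_mul] at hsub
  rw [← hsub]
  refine intervalIntegral.integral_congr fun x _ => ?_
  simp only [hf, hq, distIntegrand, ← hK]
  rw [show K * x + (K + 1) - 1 = K * (x + 1) by ring,
    show K * x + (K + 1) = K * (x + 1) + 1 by ring]
  ring

end Model

lemma integrableOn_rpow_mul_exp {b : ℝ} (hb : 0 < b) (c : ℝ) :
    IntegrableOn (fun γ : ℝ => γ ^ (-(1 / 2) : ℝ) * c * Real.exp (-(b / 2) * γ)) (Ioi 0) := by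
  have h := integrableOn_rpow_mul_exp_neg_mul_rpow (p := 1) (s := -(1 / 2)) (b := b / 2)
    (by norm_num) (by norm_num) (by positivity)
  simp only [Real.rpow_one] at h
  refine (h.const_mul c).congr (Eventually.of_forall fun γ => ?_)
  ring

lemma norm_asep_integrand_le {γ b c : ℝ} (hγ : 0 < γ) {z : ℂ} (hz : ‖z‖ ≤ c) :
    ‖((γ ^ (-(1 / 2) : ℝ) : ℝ) : ℂ) * z * ((Real.exp (-(b / 2) * γ) : ℝ) : ℂ)‖ ≤
      γ ^ (-(1 / 2) : ℝ) * c * Real.exp (-(b / 2) * γ) := by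
  have h1 := Real.rpow_pos_of_pos hγ (-(1 / 2))
  rw [norm_mul, norm_mul, Complex.norm_real, Complex.norm_real, Real.norm_of_nonneg h1.le,
    Real.norm_of_nonneg (Real.exp_pos _).le]
  gcongr

/-- Dominated convergence for the average symbol error probability. -/
lemma tendsto_asep {a b c : ℝ} (hb : 0 < b) {F : ℕ → ℝ → ℂ} {F' : ℝ → ℂ}
    (hint : ∀ N, IntegrableOn (fun γ : ℝ => ((γ ^ (-(1 / 2) : ℝ) : ℝ) : ℂ) * F N γ *
      ((Real.exp (-(b / 2) * γ) : ℝ) : ℂ)) (Ioi 0))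
    (hbound : ∀ N, ∀ γ, 0 < γ → ‖F N γ‖ ≤ c)
    (hlim : ∀ γ, 0 < γ → Tendsto (fun N => F N γ) atTop (𝓝 (F' γ))) :
    Tendsto (fun N => asep a b (F N)) atTop (𝓝 (asep a b F')) := by
  refine Tendsto.const_mul _ (tendsto_integral_of_dominated_convergence
    (fun γ => γ ^ (-(1 / 2) : ℝ) * c * Real.exp (-(b / 2) * γ))
    (fun N => (hint N).aestronglyMeasurable) (integrableOn_rpow_mul_exp hb c) (fun N => ?_) ?_)
  · filter_upwards [ae_restrict_mem measurableSet_Ioi] with γ hγ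
    exact norm_asep_integrand_le hγ (hbound N γ hγ)
  · filter_upwards [ae_restrict_mem measurableSet_Ioi] with γ hγ
    exact ((hlim γ hγ).const_mul _).mul_const _

end THz

theorem mainTheorem4
    (α μ β m lam δ γ₀ κ d₀ RM a b Ωf : ℝ)
    (hα : 0 < α) (hμ : 0 < μ) (hβ : 2 < β) (hm : max (2 / α) 1 < m) (hlam : 0 < lam)
    (hδ : δ ∈ Set.Icc (2 : ℝ) 6) (hγ₀ : 0 < γ₀) (hκ : 0 ≤ κ) (hd₀ : 0 < d₀) (hRM : 0 < RM)
    (hb : 0 < b) (hΩf : 0 < Ωf)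
    -- the random waypoint parameters; the resulting function is a density
    {l : ℕ} (B ν : Fin l → ℝ) (hν : ∀ i, 0 ≤ ν i) (hrwp : ∀ d, 0 ≤ rwpPDF d₀ RM B ν d)
    -- pointing error, fading and distance: independent, with the laws of the model
    {Ω : Type*} [MeasurableSpace Ω] (P : Measure Ω) [IsProbabilityMeasure P]
    (Hp Hf D : Ω → ℝ) (hHp : Measurable Hp) (hHf : Measurable Hf) (hD : Measurable D)
    (hindep : iIndepFun ![Hp, Hf, D] P)
    (hlawp : P.map (fun ω => Hp ω ^ 2) =
      volume.withDensity (fun z => ENNReal.ofReal (pointingPDF β z)))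
    (hlawf : P.map (fun ω => Hf ω ^ 2) =
      volume.withDensity (fun x => ENNReal.ofReal (alphaFPDF α μ m lam Ωf x)))
    (hlawD : P.map D = volume.withDensity (fun d => ENNReal.ofReal (rwpPDF d₀ RM B ν d)))
    -- normalization of the joint pointing error and fading power
    (hnorm : (∫ ω, Hp ω ^ 2 ∂P) * Ωf = 1) :
    -- all the Fox H-functions involved are well defined
    (∀ z : ℝ, 0 < z →
      FoxWellDefined 3 2 (cdfUpper α μ β m) (foxLower α μ β) z ∧
      FoxWellDefined 3 3 (asepUpper α μ β m) (foxLower α μ β) z) ∧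
    -- for every number of nodes, the closed form is the error probability of the
    -- distribution function in its quadrature form
    (∀ N : ℕ,
      IntegrableOn (fun γ : ℝ => ((γ ^ (-(1 / 2) : ℝ) : ℝ) : ℂ) *
        quadCDF α μ β m lam δ γ₀ κ d₀ RM B ν N γ * ((Real.exp (-(b / 2) * γ) : ℝ) : ℂ))
        (Set.Ioi 0) ∧
      asep a b (quadCDF α μ β m lam δ γ₀ κ d₀ RM B ν N) =
        asepClosed α μ β m lam δ γ₀ κ d₀ RM a b B ν N) ∧
    -- the closed form is the Gauss-Legendre approximation of the error probability of the
    -- model, which it attains in the limit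
    IntegrableOn (fun γ : ℝ => ((γ ^ (-(1 / 2) : ℝ) : ℝ) : ℂ) *
        ((P.real {ω | snr γ₀ δ κ d₀ (D ω) (Hp ω) (Hf ω) ≤ γ} : ℝ) : ℂ) *
        ((Real.exp (-(b / 2) * γ) : ℝ) : ℂ)) (Set.Ioi 0) ∧
    Tendsto (fun N : ℕ => asepClosed α μ β m lam δ γ₀ κ d₀ RM a b B ν N) atTop
      (𝓝 (asep a b
        (fun γ => ((P.real {ω | snr γ₀ δ κ d₀ (D ω) (Hp ω) (Hf ω) ≤ γ} : ℝ) : ℂ)))) := by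
  have hm1 : 1 < m := (le_max_right _ _).trans_lt hm
  have hβ0 : 0 < β := by linarith
  have hδ0 : 0 ≤ δ := by linarith [hδ.1]
  set U : Ω → ℝ := fun ω => Hp ω ^ 2 with hU
  set V : Ω → ℝ := fun ω => Hf ω ^ 2 with hV
  have hUm : Measurable U := hHp.pow_const 2
  have hVm : Measurable V := hHf.pow_const 2
  have hmeas : ∀ i, Measurable (![Hp, Hf, D] i) := by
    intro i
    fin_cases i
    · exact hHp
    · exact hHf
    · exact hD
  have hUV : U ⟂ᵢ[P] V := by
    have h := hindep.indepFun (show (0 : Fin 3) ≠ 1 by decide)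
    exact h.comp (φ := fun x : ℝ => x ^ 2) (ψ := fun x : ℝ => x ^ 2) (by fun_prop) (by fun_prop)
  have hWD : (fun ω => U ω * V ω) ⟂ᵢ[P] D := by
    have h := hindep.indepFun_prodMk hmeas 0 1 2 (by decide) (by decide)
    exact h.comp (φ := fun x : ℝ × ℝ => x.1 ^ 2 * x.2 ^ 2) (ψ := fun x : ℝ => x) (by fun_prop)
      measurable_id
  have hV0 := ae_gt_of_law hVm (fun x hx => alphaFPDF_of_nonpos α μ m lam Ωf hx) hlawf
  have hUa : ∀ u, P.map U {u} = 0 := fun u => by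
    rw [hlawp]
    exact withDensity_absolutelyContinuous _ _ (by simp)
  set F : ℝ → ℝ := fun y => P.real {ω | U ω * V ω ≤ y} with hF
  have hFc : Continuous F := continuous_measureReal_le (hUm.mul hVm)
    (measure_mul_eq_zero hUm hVm hUV hUa hV0)
  have hF1 : ∀ y, |F y| ≤ 1 := fun y => by
    rw [abs_of_nonneg measureReal_nonneg]
    exact measureReal_le_one
  have hG : IsInverseTransform α μ β m (foxFun α μ β m (c₂ α μ β m lam) F) :=
    ⟨hα, hμ, hβ0, by linarith, fun x hx => continuousAt_foxFun hα hFc hx,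
      fun s hs => hasMellin_foxFun hα hμ hβ0 hm1 hlam hΩf hUm hVm hUV hlawp hlawf hnorm hs⟩
  have hquad := integral_quadCDF (δ := δ) (κ := κ) (B := B) (ν := ν) hμ hβ0 hm1 hlam hd₀ hRM hγ₀
    hG (a := a) hb
  refine ⟨fun z hz => ⟨hG.foxWellDefined_cdf hz, hG.foxWellDefined_asep hz⟩, hquad, ?_, ?_⟩
  · have hmono : Monotone fun γ => P.real {ω | snr γ₀ δ κ d₀ (D ω) (Hp ω) (Hf ω) ≤ γ} :=
      fun γ γ' h => measureReal_mono fun ω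
        (hω : snr γ₀ δ κ d₀ (D ω) (Hp ω) (Hf ω) ≤ γ) => hω.trans h
    have hm' := hmono.measurable
    refine Integrable.mono' (integrableOn_rpow_mul_exp hb 1)
      (Measurable.aestronglyMeasurable (by fun_prop)) ?_
    filter_upwards [ae_restrict_mem measurableSet_Ioi] with γ hγ
    refine norm_asep_integrand_le hγ ?_
    rw [Complex.norm_real, Real.norm_of_nonneg measureReal_nonneg]
    exact measureReal_le_one
  · obtain ⟨c, hc⟩ := exists_abs_distIntegrand_le (d₀ := d₀) (RM := RM) (B := B) δ κ hF1 hν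
    have hc0 : 0 ≤ c := (abs_nonneg _).trans (hc 0 0 (by norm_num))
    simp_rw [← (hquad _).2]
    refine tendsto_asep (c := 2 * c) hb (fun N => (hquad N).1) (fun N γ hγ => ?_) fun γ hγ => ?_
    · rw [quadCDF_eq hα hμ hβ0 hm1 hlam hd₀ hRM hγ₀ hG N hγ, Complex.norm_real, Real.norm_eq_abs]
      calc |∑ x ∈ glNodes N, glWeight N x * distIntegrand δ κ d₀ RM B ν F (γ / γ₀) x|
          ≤ ∑ x ∈ glNodes N, |glWeight N x * distIntegrand δ κ d₀ RM B ν F (γ / γ₀) x| :=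
            Finset.abs_sum_le_sum_abs _ _
        _ ≤ ∑ x ∈ glNodes N, glWeight N x * c := by
            refine Finset.sum_le_sum fun x hx => ?_
            have hw := glWeight_nonneg hx
            rw [abs_mul, abs_of_nonneg hw]
            exact mul_le_mul_of_nonneg_left
              (hc _ x (Set.Ioo_subset_Icc_self (mem_Ioo_of_mem_glNodes hx))) hw
        _ ≤ 2 * c := by
            rw [← Finset.sum_mul]
            exact mul_le_mul_of_nonneg_right (sum_glWeight_le N) hc0
    · simp_rw [quadCDF_eq hα hμ hβ0 hm1 hlam hd₀ hRM hγ₀ hG _ hγ,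
        measureReal_snr_le (δ := δ) (κ := κ) hd₀ hRM hγ₀ hHp hHf hD hWD hrwp hlawD γ]
      exact (Complex.continuous_ofReal.tendsto _).comp (tendsto_sum_glWeight_mul
        (continuous_distIntegrand hFc hν hδ0 _).continuousOn)
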